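/- All monoids are commutative and cancellative, and $H_{\mathrm{red}} = H/H^\times$. A *Krull monoid* is a monoid $H$ having a divisor homomorphism (a homomorphism $\varphi$ such that $\varphi(a)\mid\varphi(b)$ implies $a\mid b$) into a free abelian monoid. Let $H$ be a Krull monoid with divisor theory $\varphi\colon H\to\mathcal F(P)$, that is, $\varphi$ is a divisor homomorphism into the free abelian monoid with basis $P$, and every element of $\mathcal F(P)$ is the greatest common divisor of $\varphi(X)$ for some finite nonempty $X\subset H$. Let $G=\mathsf q(\mathcal F(P))/\mathsf q(\varphi(H))$ be the class group of $H$, written additively, and let $G_P=\{[p] : p\in P\}\subset G$ be the set of classes containing prime divisors. Notation. A factorization of $a\in H$ is a finite unordered sequence $z$ of atoms of $H_{\mathrm{red}}$ with product $aH^\times$; its length $|z|$ is the number of its terms, and $\mathsf L(a)$ is the set of lengths of factorizations of $a$. For $k\in\mathbb N$, $\mathcal U_k(H)$ is the union of all sets $\mathsf L(a)$, $a\in H$, with $k\in\mathsf L(a)$ (and $\mathcal U_k(H)=\{k\}$ if $H$ is a group), and $\rho_k(H)=\sup\mathcal U_k(H)$. The distance of two factorizations is $\mathsf d(z,z')=\max\{|z\gcd(z,z')^{-1}|,\,|z'\gcd(z,z')^{-1}|\}$.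 The catenary degree $\mathsf c(H)$ is the least $N\in\mathbb N_0\cup\{\infty\}$ such that for all $a\in H$ any two factorizations $z,z'$ of $a$ are joined by factorizations $z=z_0,\dots,z_k=z'$ of $a$ with $\mathsf d(z_{i-1},z_i)\le N$ for all $i$. The tame degree $\mathsf t(H)$ is the least $N\in\mathbb N_0\cup\{\infty\}$ such that, for every atom $u$ of $H_{\mathrm{red}}$ and every factorization $z$ of a multiple of $u$ which does not contain $u$, there are a subproduct $v_1\cdots v_m$ of $z$ and atoms $u_2,\dots,u_\ell$ of $H_{\mathrm{red}}$ with $v_1\cdots v_m=u\,u_2\cdots u_\ell$ and $\max\{\ell,m\}\le N$. The Davenport constant $\mathsf D(G_P)$ is the supremum of the lengths of the minimal zero-sum sequences over $G_P$ (the atoms of the monoid $\mathcal B(G_P)$ of finite unordered zero-sum sequences over $G_P$). An interval is a nonempty set of the form $\{x\in\mathbb Z : a\le x\le b\}$ with integers $a \le b$. **Corollary 5.5.** Suppose that $G$ is free abelian with basis $(e_1,\dots,e_r)$, $r\in\{2,3\}$, and that $G_P=G_r^+\cup -G_r^+$, where $$G_r^+=\Big\{\sum_{i=1}^r\epsilon_ie_i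 : \epsilon_i\in\{0,1\},\ \text{not all } \epsilon_i \text{ equal to } 0\Big\}.$$ 1. If $r=2$, then $\mathsf c(H)=\mathsf t(H)=\mathsf D(G_P)=3$; for each $k\ge2$ the set $\mathcal U_k(H)$ is an interval; and $\rho_{2k+j}(H)=3k+j$ for all $k\ge2$ and $j\in\{0,1\}$. 2. If $r=3$, then $\mathsf c(H)=\mathsf D(G_P)=5$; for each $k\ge2$ the set $\mathcal U_k(H)$ is an interval; and $\rho_{2k+j}(H)=5k+j$ for all $k\ge2$ and $j\in\{0,1\}$. -/

import Mathlib

open scoped Pointwise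

noncomputable section

namespace KrullFact

/-! ### Factorizations and sets of lengths

A monoid is a commutative cancellative monoid (`CancelCommMonoid H`); its atoms are Mathlib's
`Irreducible` elements, and the associated reduced monoid `H / Hˣ` is `Associates H`. -/

section Factorizations

variable (H : Type*) [CancelCommMonoid H]

/-- The factorization monoid `Z(H)`, the free abelian monoid on the atoms of `H_red`: finite
multisets all of whose members are atoms of `H_red`. -/
def factorizationMonoid : Set (Multiset (Associates H)) :=
  {z | ∀ u ∈ z, Irreducible u}

variable {H}

/-- `Z(a)`: the factorizations of `a` (more precisely of its class `a Hˣ`). -/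
def factorizations (a : H) : Set (Multiset (Associates H)) :=
  {z | z ∈ factorizationMonoid H ∧ z.prod = Associates.mk a}

/-- `L(a)`: the set of lengths of `a`. -/
def lengths (a : H) : Set ℕ :=
  Multiset.card '' factorizations a

variable (H)

open Classical in
/-- `U_k(H)`: the union of all sets of lengths containing `k`
(and `{k}` if `H` is a group). -/
def unionLengths (k : ℕ) : Set ℕ :=
  if ∀ a : H, IsUnit a then {k}
  else {l | ∃ a : H, k ∈ lengths a ∧ l ∈ lengths a}

/-- `ρ_k(H) = sup U_k(H)`, as an element of `ℕ ∪ {∞}`. -/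
def rho (k : ℕ) : ℕ∞ :=
  ⨆ l ∈ unionLengths H k, (l : ℕ∞)

variable {H}

open Classical in
/-- The distance of two factorizations: after cancelling the greatest common divisor, the larger
of the two remaining lengths. (The truncated difference `z - z'` of multisets is
`z · gcd(z, z')⁻¹`.) -/
def dist (z z' : Multiset (Associates H)) : ℕ :=
  max (Multiset.card (z - z')) (Multiset.card (z' - z))

/-- The catenary degree `c(a)` of an element: the least `N ∈ ℕ ∪ {∞}` such that any two
factorizations of `a` are joined by a finite chain of factorizations of `a` in which successive
members have distance at most `N`. -/
def catenaryDegreeOf (a : H) : ℕ∞ :=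
  sInf {N : ℕ∞ | ∀ z ∈ factorizations a, ∀ z' ∈ factorizations a,
    Relation.ReflTransGen
      (fun x y => x ∈ factorizations a ∧ y ∈ factorizations a ∧ (dist x y : ℕ∞) ≤ N) z z'}

/-- The local tame degree `t(H, u)` of an atom `u` of `H_red`: the least `N ∈ ℕ ∪ {∞}` such that
every factorization `z` which does not contain `u`, of a multiple of `u`, has a subproduct `y` of
at most `N` factors which is a multiple of `u` and has a factorization `u · w` containing `u`
with at most `N` factors. -/
def localTameDegree (u : Associates H) : ℕ∞ :=
  sInf {N : ℕ∞ | ∀ z ∈ factorizationMonoid H, u ∣ z.prod → u ∉ z →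
    ∃ y ≤ z, ∃ w ∈ factorizationMonoid H, y.prod = u * w.prod ∧
      ((max (Multiset.card w + 1) (Multiset.card y) : ℕ) : ℕ∞) ≤ N}

variable (H)

/-- The catenary degree `c(H)`. -/
def catenaryDegree : ℕ∞ :=
  ⨆ a : H, catenaryDegreeOf a

/-- The (global) tame degree `t(H)`. -/
def tameDegree : ℕ∞ :=
  ⨆ u : {u : Associates H // Irreducible u}, localTameDegree u.1

end Factorizations

/-- A (finite, nonempty) interval of nonnegative integers. -/
def IsInterval (S : Set ℕ) : Prop :=
  ∃ a b : ℕ, a ≤ b ∧ S = Set.Icc a b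

/-! ### Krull monoids, divisor theories and class groups -/

/-- The (multiplicative) free abelian monoid `F(P)` with basis `P`. -/
abbrev FreeMon (P : Type*) : Type _ := Multiplicative (Multiset P)

/-- A divisor homomorphism. -/
def IsDivisorHom {H D : Type*} [CommMonoid H] [CommMonoid D] (φ : H →* D) : Prop :=
  ∀ a b : H, φ a ∣ φ b → a ∣ b

/-- `H` is a Krull monoid: it has a divisor homomorphism into a free abelian monoid. -/
def IsKrull.{u} (H : Type u) [CancelCommMonoid H] : Prop :=
  ∃ (P : Type u) (φ : H →* FreeMon P), IsDivisorHom φ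

/-- `φ : H → F(P)` is a divisor theory: a divisor homomorphism such that every element of `F(P)`
is the greatest common divisor of `φ(X)` for some finite nonempty `X ⊆ H`. -/
structure IsDivisorTheory {H P : Type*} [CancelCommMonoid H] (φ : H →* FreeMon P) : Prop where
  isDivisorHom : IsDivisorHom φ
  exists_gcd : ∀ a : FreeMon P, ∃ X : Finset H, X.Nonempty ∧
    (∀ x ∈ X, a ∣ φ x) ∧ ∀ d : FreeMon P, (∀ x ∈ X, d ∣ φ x) → d ∣ a

section ClassGroups

variable {H P : Type*} [CancelCommMonoid H] (φ : H →* FreeMon P)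

/-- `q(φ(H))`, as a subgroup of the quotient group `q(F(P))`. -/
def principalDivisors : Subgroup (Algebra.GrothendieckGroup (FreeMon P)) :=
  Subgroup.closure (Set.range fun h : H => Algebra.GrothendieckGroup.of (φ h))

/-- The class group `q(F(P)) / q(φ(H))`, written additively. When `φ` is a divisor theory, this
is the class group of `H`. -/
abbrev DivClassGroup : Type _ :=
  Additive (Algebra.GrothendieckGroup (FreeMon P) ⧸ principalDivisors φ)

/-- The class `[a]` of `a ∈ F(P)`. -/
def divClass (a : FreeMon P) : DivClassGroup φ :=
  Additive.ofMul (QuotientGroup.mk (Algebra.GrothendieckGroup.of a))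

/-- `G_P`: the set of classes `[p]`, `p ∈ P`, containing prime divisors. -/
def primeClasses : Set (DivClassGroup φ) :=
  Set.range fun p : P => divClass φ (Multiplicative.ofAdd {p})

end ClassGroups

/-! ### Zero-sum sequences -/

section ZeroSum

variable {G : Type*} [AddCommGroup G]

/-- The monoid `B(G₀)` of zero-sum sequences over `G₀`. (Sequences are finite and unordered, that
is, multisets; the monoid operation is concatenation, the sum of multisets.) -/
def zeroSumMonoid (G₀ : Set G) : AddSubmonoid (Multiset G) where
  carrier := {S | (∀ g ∈ S, g ∈ G₀) ∧ S.sum = 0}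
  zero_mem' := by simp
  add_mem' := by
    rintro S T ⟨hS, hS'⟩ ⟨hT, hT'⟩
    refine ⟨fun g hg => ?_, by rw [Multiset.sum_add, hS', hT', add_zero]⟩
    rcases Multiset.mem_add.1 hg with h | h
    exacts [hS g h, hT g h]

/-- The Davenport constant `D(G₀)`: the supremum of the lengths of the atoms of `B(G₀)`. -/
def davenport (G₀ : Set G) : ℕ∞ :=
  ⨆ U : {U : zeroSumMonoid G₀ // AddIrreducible U}, ((Multiset.card U.1.1 : ℕ) : ℕ∞)

/-- For a family `e = (e_i)`, the set `{∑ ε_i e_i : ε_i ∈ {0, 1}, not all zero}` of nonzero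
vertices of the hypercube. -/
def hypercube {ι : Type*} (e : ι → G) : Set G :=
  {g | ∃ I : Finset ι, I.Nonempty ∧ g = ∑ i ∈ I, e i}

end ZeroSum

end KrullFact

end

/-! A divisor homomorphism identifies `H_red` with the multisets of primes whose classes sum to zero
(`exists_isZeroSumModel`), and basis coordinates turn these classes into the nonzero cube vertices
and their negatives. Atoms become minimal zero-sum multisets. Their weights lie in an explicit
finite list: the pairs {x, -x} and the Graver relations between the vertices (`exists_minimal2_le`,
`exists_minimal3_le`). Hence every atom has between 2 and D primes, where D = 3 or 5, and D is
attained.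

Catenary degree: a factorization with more than D factors can be changed, inside a proper
subproduct, so as to contain any prescribed atom of another factorization; induction then gives c ≤
D (`joined`). Conversely, for an atom U of length D and its negative U', the product UU' has,
besides {U, U'}, only factorizations into D pairs.

Unions of sets of lengths: counting primes in equal products of k and l atoms gives 2l ≤ Dk. This is
sharp enough except when D = 5 and k is odd, where it overshoots by one; a mod 2 invariant vanishing
exactly on the atoms of length 2 and 5 excludes the extra value. Products of an atom with its
negative put 2, ..., D into U_2. Adding such lengths fills the range from k up to the bound, and the
symmetry of "l lies in U_k" handles the values below k.

Tame degree in rank two: at most |u| ≤ 3 factors suffice to cover u, and the only configuration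
violating the bound is excluded by an integer-valued character. -/

noncomputable section

namespace KrullFact

/-! ### Minimal zero-sum multisets -/

section MinZeroSum

variable {P A B : Type*} [AddCommGroup A] [AddCommGroup B]

/-- `S` is a minimal multiset with respect to having zero sum under the weight `σ`. -/
def MinZeroSum (σ : P → A) (S : Multiset P) : Prop :=
  S ≠ 0 ∧ (S.map σ).sum = 0 ∧ ∀ T ≤ S, (T.map σ).sum = 0 → T = 0 ∨ T = S

theorem exists_le_map_eq {α β : Type*} (f : α → β) {S : Multiset α} {T : Multiset β}
    (h : T ≤ S.map f) : ∃ S' ≤ S, S'.map f = T := by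
  induction S using Quotient.inductionOn with | _ l
  induction T using Quotient.inductionOn with | _ t
  obtain ⟨l', hl', hs⟩ := h
  obtain ⟨m, hm, rfl⟩ := List.sublist_map_iff.1 hs
  exact ⟨(m : Multiset α), Multiset.coe_le.2 hm.subperm, Multiset.coe_eq_coe.2 hl'⟩

/-- Minimality depends only on the weights, so `τ` need not be injective: several primes may share a
class. -/
theorem minZeroSum_map {α : Type*} (σ : α → A) (τ : P → α) (S : Multiset P) :
    MinZeroSum σ (S.map τ) ↔ MinZeroSum (fun p => σ (τ p)) S := by
  simp only [MinZeroSum, Multiset.map_map, Function.comp_apply, ne_eq, Multiset.map_eq_zero]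
  refine and_congr_right fun _ => and_congr_right fun _ => ⟨fun h T hT h0 => ?_, fun h T hT h0 => ?_⟩
  · rcases h (T.map τ) (Multiset.map_le_map hT) (by simpa using h0) with h | h
    · exact .inl (by simpa using h)
    · exact .inr (Multiset.eq_of_le_of_card_le hT (by
        simpa using (congrArg Multiset.card h).ge))
  · obtain ⟨T', hT', rfl⟩ := exists_le_map_eq τ hT
    rcases h T' hT' (by simpa using h0) with h | h
    · exact .inl (by simp [h])
    · exact .inr (by simp [h])

theorem minZeroSum_comp_iff (σ : P → A) (f : A →+ B) (hf : Function.Injective f)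
    (S : Multiset P) : MinZeroSum (fun p => f (σ p)) S ↔ MinZeroSum σ S := by
  have key : ∀ T : Multiset P, (T.map fun p => f (σ p)).sum = 0 ↔ (T.map σ).sum = 0 := fun T => by
    rw [← map_eq_zero_iff f hf, map_multiset_sum, Multiset.map_map]; rfl
  simp only [MinZeroSum, key]

theorem minZeroSum_pair {σ : P → A} {p q : P} (hp : σ p ≠ 0) (hpq : σ p + σ q = 0) :
    MinZeroSum σ {p, q} := by
  refine ⟨by simp, by simpa using hpq, fun T hT h0 => ?_⟩
  have hc := Multiset.card_le_card hT
  have h2 : Multiset.card ({p, q} : Multiset P) = 2 := rfl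
  have hq : σ q ≠ 0 := fun h => hp (by simpa [h] using hpq)
  rcases (by omega : Multiset.card T = 0 ∨ Multiset.card T = 1 ∨ 2 ≤ Multiset.card T)
    with h | h | h
  · exact .inl (Multiset.card_eq_zero.1 h)
  · obtain ⟨t, rfl⟩ := Multiset.card_eq_one.1 h
    have : t = p ∨ t = q := by simpa using Multiset.singleton_le.1 hT
    rcases this with rfl | rfl <;> simp_all
  · exact .inr (Multiset.eq_of_le_of_card_le hT (by omega))

theorem le_iff_forall_mem_count_le {α : Type*} [DecidableEq α] {S T : Multiset α} :
    S ≤ T ↔ ∀ x ∈ S, S.count x ≤ T.count x := by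
  refine ⟨fun h x _ => Multiset.le_iff_count.1 h x, fun h => Multiset.le_iff_count.2 fun x => ?_⟩
  by_cases hx : x ∈ S
  · exact h x hx
  · simp [Multiset.count_eq_zero_of_notMem hx]

/-- A member of `L` below the weights of `S` lifts to a nonzero zero-sum part of `S`, which is all
of `S` by minimality. Only completeness of `L` matters; its members need not be known to be minimal.
-/
theorem MinZeroSum.map_mem {α : Type*} [AddCommGroup α] {L : List (Multiset α)}
    (hL : ∀ u ∈ L, u ≠ 0 ∧ u.sum = 0) {C : List α}
    (hC : ∀ T : Multiset α, (∀ x ∈ T, x ∈ C) → T ≠ 0 → T.sum = 0 → ∃ u ∈ L, u ≤ T)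
    {σ : P → α} {S : Multiset P} (hσ : ∀ p ∈ S, σ p ∈ C) (hS : MinZeroSum σ S) :
    S.map σ ∈ L := by
  obtain ⟨u, hu, hle⟩ := hC (S.map σ) (by simpa using hσ) (by simpa using hS.1) hS.2.1
  obtain ⟨T, hT, rfl⟩ := exists_le_map_eq σ hle
  rcases hS.2.2 T hT (hL _ hu).2 with rfl | rfl
  · simpa using (hL _ hu).1
  · exact hu

end MinZeroSum

/-! ### The cube in rank two -/

/-- The nonzero vertices of the square and their negatives. -/
def cubeVecs2 : List (ℤ × ℤ) :=
  [(1, 0), (0, 1), (1, 1), (-1, 0), (0, -1), (-1, -1)]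

/-- The minimal zero-sum multisets over `cubeVecs2`. -/
def minimal2 : List (Multiset (ℤ × ℤ)) :=
  [{(1, 0), (-1, 0)}, {(0, 1), (0, -1)}, {(1, 1), (-1, -1)},
   {(1, 1), (-1, 0), (0, -1)}, {(-1, -1), (1, 0), (0, 1)}]

theorem exists_minimal2_le (T : Multiset (ℤ × ℤ)) (hT : ∀ x ∈ T, x ∈ cubeVecs2) (h0 : T ≠ 0)
    (hs : T.sum = 0) : ∃ u ∈ minimal2, u ≤ T := by
  by_contra! h
  apply h0
  rw [Finset.sum_multiset_count_of_subset T cubeVecs2.toFinset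
    (fun x hx => by simpa using hT x (by simpa using hx)),
    -- The zero sum and the absence of every listed multiset are now rewritten as linear conditions
    -- on the multiplicities in `T`.
    List.sum_toFinset _ (by decide)] at hs
  simp [cubeVecs2, Prod.ext_iff] at hs
  simp only [minimal2, List.forall_mem_cons, le_iff_forall_mem_count_le,
    Multiset.insert_eq_cons, Multiset.mem_cons, Multiset.mem_singleton, forall_eq_or_imp,
    forall_eq, Multiset.count_cons, Multiset.count_singleton, Prod.mk.injEq] at h
  norm_num at h
  simp only [← Multiset.one_le_count_iff_mem] at h
  refine Multiset.eq_zero_of_forall_notMem fun x hx => ?_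
  have hx' := Multiset.one_le_count_iff_mem.2 hx
  have := hT x hx
  simp only [cubeVecs2, List.mem_cons, List.not_mem_nil, or_false] at this
  rcases this with rfl | rfl | rfl | rfl | rfl | rfl <;> omega

theorem minimal2_ne_zero : ∀ u ∈ minimal2, u ≠ 0 ∧ u.sum = 0 := by decide

/-! ### The cube in rank three -/

/-- The nonzero vertices of the cube and their negatives. -/
def cubeVecs3 : List (ℤ × ℤ × ℤ) :=
  [(1, 0, 0), (0, 1, 0), (0, 0, 1), (1, 1, 0), (1, 0, 1), (0, 1, 1), (1, 1, 1),
   (-1, 0, 0), (0, -1, 0), (0, 0, -1), (-1, -1, 0), (-1, 0, -1), (0, -1, -1), (-1, -1, -1)]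

/-- The minimal zero-sum multisets over `cubeVecs3`: seven pairs of opposite vectors, and the
multisets given by the Graver basis of the matrix whose columns are the vertices of the cube. -/
def minimal3 : List (Multiset (ℤ × ℤ × ℤ)) :=
  [{(1, 0, 0), (-1, 0, 0)}, {(0, 1, 0), (0, -1, 0)}, {(0, 0, 1), (0, 0, -1)},
   {(1, 1, 0), (-1, -1, 0)}, {(1, 0, 1), (-1, 0, -1)}, {(0, 1, 1), (0, -1, -1)},
   {(1, 1, 1), (-1, -1, -1)}, {(1, 0, 0), (0, 1, 0), (-1, -1, 0)},
   {(-1, 0, 0), (0, -1, 0), (1, 1, 0)}, {(0, 0, -1), (-1, -1, 0), (1, 1, 1)},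
   {(0, 0, 1), (1, 1, 0), (-1, -1, -1)}, {(1, 0, 0), (0, 0, 1), (-1, 0, -1)},
   {(-1, 0, 0), (0, 0, -1), (1, 0, 1)}, {(0, -1, 0), (-1, 0, -1), (1, 1, 1)},
   {(0, 1, 0), (1, 0, 1), (-1, -1, -1)}, {(0, 1, 0), (0, 0, 1), (0, -1, -1)},
   {(0, -1, 0), (0, 0, -1), (0, 1, 1)}, {(-1, 0, 0), (0, -1, -1), (1, 1, 1)},
   {(1, 0, 0), (0, 1, 1), (-1, -1, -1)}, {(1, 0, 0), (-1, -1, 0), (-1, 0, -1), (1, 1, 1)},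
   {(-1, 0, 0), (1, 1, 0), (1, 0, 1), (-1, -1, -1)},
   {(0, 1, 0), (-1, -1, 0), (0, -1, -1), (1, 1, 1)},
   {(0, -1, 0), (1, 1, 0), (0, 1, 1), (-1, -1, -1)},
   {(1, 0, 0), (0, 0, -1), (-1, -1, 0), (0, 1, 1)},
   {(-1, 0, 0), (0, 0, 1), (1, 1, 0), (0, -1, -1)},
   {(0, 1, 0), (0, 0, -1), (-1, -1, 0), (1, 0, 1)},
   {(0, -1, 0), (0, 0, 1), (1, 1, 0), (-1, 0, -1)},
   {(0, 0, 1), (-1, 0, -1), (0, -1, -1), (1, 1, 1)},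
   {(0, 0, -1), (1, 0, 1), (0, 1, 1), (-1, -1, -1)},
   {(1, 0, 0), (0, -1, 0), (-1, 0, -1), (0, 1, 1)},
   {(-1, 0, 0), (0, 1, 0), (1, 0, 1), (0, -1, -1)},
   {(1, 0, 0), (0, 1, 0), (0, 0, 1), (-1, -1, -1)},
   {(-1, 0, 0), (0, -1, 0), (0, 0, -1), (1, 1, 1)},
   {(-1, -1, 0), (-1, 0, -1), (0, -1, -1), (1, 1, 1), (1, 1, 1)},
   {(1, 1, 0), (1, 0, 1), (0, 1, 1), (-1, -1, -1), (-1, -1, -1)},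
   {(1, 0, 0), (1, 0, 0), (-1, -1, 0), (-1, 0, -1), (0, 1, 1)},
   {(-1, 0, 0), (-1, 0, 0), (1, 1, 0), (1, 0, 1), (0, -1, -1)},
   {(0, 1, 0), (0, 1, 0), (-1, -1, 0), (1, 0, 1), (0, -1, -1)},
   {(0, -1, 0), (0, -1, 0), (1, 1, 0), (-1, 0, -1), (0, 1, 1)},
   {(0, 0, -1), (0, 0, -1), (-1, -1, 0), (1, 0, 1), (0, 1, 1)},
   {(0, 0, 1), (0, 0, 1), (1, 1, 0), (-1, 0, -1), (0, -1, -1)}]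

/-- Every nonzero integer relation between the vertices of the cube has a conformal part in the
Graver basis. -/
theorem cube_relation_eq_zero {a b c d e f g : ℤ} (ha : a + d + e + g = 0)
    (hb : b + d + f + g = 0) (hc : c + e + f + g = 0)
    (h0 : ¬(1 ≤ a ∧ 1 ≤ b ∧ d ≤ -1)) (h1 : ¬(a ≤ -1 ∧ b ≤ -1 ∧ 1 ≤ d))
    (h2 : ¬(c ≤ -1 ∧ d ≤ -1 ∧ 1 ≤ g)) (h3 : ¬(1 ≤ c ∧ 1 ≤ d ∧ g ≤ -1))
    (h4 : ¬(1 ≤ a ∧ 1 ≤ c ∧ e ≤ -1)) (h5 : ¬(a ≤ -1 ∧ c ≤ -1 ∧ 1 ≤ e))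
    (h6 : ¬(b ≤ -1 ∧ e ≤ -1 ∧ 1 ≤ g)) (h7 : ¬(1 ≤ b ∧ 1 ≤ e ∧ g ≤ -1))
    (h8 : ¬(1 ≤ b ∧ 1 ≤ c ∧ f ≤ -1)) (h9 : ¬(b ≤ -1 ∧ c ≤ -1 ∧ 1 ≤ f))
    (h10 : ¬(a ≤ -1 ∧ f ≤ -1 ∧ 1 ≤ g)) (h11 : ¬(1 ≤ a ∧ 1 ≤ f ∧ g ≤ -1))
    (h12 : ¬(1 ≤ a ∧ d ≤ -1 ∧ e ≤ -1 ∧ 1 ≤ g)) (h13 : ¬(a ≤ -1 ∧ 1 ≤ d ∧ 1 ≤ e ∧ g ≤ -1))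
    (h14 : ¬(1 ≤ b ∧ d ≤ -1 ∧ f ≤ -1 ∧ 1 ≤ g)) (h15 : ¬(b ≤ -1 ∧ 1 ≤ d ∧ 1 ≤ f ∧ g ≤ -1))
    (h16 : ¬(1 ≤ a ∧ c ≤ -1 ∧ d ≤ -1 ∧ 1 ≤ f)) (h17 : ¬(a ≤ -1 ∧ 1 ≤ c ∧ 1 ≤ d ∧ f ≤ -1))
    (h18 : ¬(1 ≤ b ∧ c ≤ -1 ∧ d ≤ -1 ∧ 1 ≤ e)) (h19 : ¬(b ≤ -1 ∧ 1 ≤ c ∧ 1 ≤ d ∧ e ≤ -1))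
    (h20 : ¬(1 ≤ c ∧ e ≤ -1 ∧ f ≤ -1 ∧ 1 ≤ g)) (h21 : ¬(c ≤ -1 ∧ 1 ≤ e ∧ 1 ≤ f ∧ g ≤ -1))
    (h22 : ¬(1 ≤ a ∧ b ≤ -1 ∧ e ≤ -1 ∧ 1 ≤ f)) (h23 : ¬(a ≤ -1 ∧ 1 ≤ b ∧ 1 ≤ e ∧ f ≤ -1))
    (h24 : ¬(1 ≤ a ∧ 1 ≤ b ∧ 1 ≤ c ∧ g ≤ -1)) (h25 : ¬(a ≤ -1 ∧ b ≤ -1 ∧ c ≤ -1 ∧ 1 ≤ g))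
    (h26 : ¬(d ≤ -1 ∧ e ≤ -1 ∧ f ≤ -1 ∧ 2 ≤ g)) (h27 : ¬(1 ≤ d ∧ 1 ≤ e ∧ 1 ≤ f ∧ g ≤ -2))
    (h28 : ¬(2 ≤ a ∧ d ≤ -1 ∧ e ≤ -1 ∧ 1 ≤ f)) (h29 : ¬(a ≤ -2 ∧ 1 ≤ d ∧ 1 ≤ e ∧ f ≤ -1))
    (h30 : ¬(2 ≤ b ∧ d ≤ -1 ∧ 1 ≤ e ∧ f ≤ -1)) (h31 : ¬(b ≤ -2 ∧ 1 ≤ d ∧ e ≤ -1 ∧ 1 ≤ f))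
    (h32 : ¬(c ≤ -2 ∧ d ≤ -1 ∧ 1 ≤ e ∧ 1 ≤ f)) (h33 : ¬(2 ≤ c ∧ 1 ≤ d ∧ e ≤ -1 ∧ f ≤ -1)) :
    d = 0 ∧ e = 0 ∧ f = 0 ∧ g = 0 := by
  -- The signs of the three face diagonals are fixed; in each case the equations for `a`, `b`, `c`
  -- and the excluded patterns leave only the zero relation.
  rcases lt_trichotomy d 0 with hd | hd | hd <;> rcases lt_trichotomy e 0 with he | he | he <;>
    rcases lt_trichotomy f 0 with hf | hf | hf <;> grind (splits := 30)

theorem exists_minimal3_le (T : Multiset (ℤ × ℤ × ℤ)) (hT : ∀ x ∈ T, x ∈ cubeVecs3) (h0 : T ≠ 0)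
    (hs : T.sum = 0) : ∃ u ∈ minimal3, u ≤ T := by
  by_contra! h
  apply h0
  rw [Finset.sum_multiset_count_of_subset T cubeVecs3.toFinset
    (fun x hx => by simpa using hT x (by simpa using hx)),
    List.sum_toFinset _ (by decide)] at hs
  simp [cubeVecs3, Prod.ext_iff] at hs
  simp only [minimal3, List.forall_mem_cons, le_iff_forall_mem_count_le,
    Multiset.insert_eq_cons, Multiset.mem_cons, Multiset.mem_singleton, forall_eq_or_imp,
    forall_eq, Multiset.count_cons, Multiset.count_singleton, Prod.mk.injEq] at h
  norm_num at h
  simp only [← Multiset.one_le_count_iff_mem] at h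
  obtain ⟨s0, s1, s2⟩ := hs
  obtain ⟨p0, p1, p2, p3, p4, p5, p6, q0, q1, q2, q3, q4, q5, q6, q7, q8, q9, q10, q11, q12, q13,
    q14, q15, q16, q17, q18, q19, q20, q21, q22, q23, q24, q25, q26, q27, q28, q29, q30,
    q31, q32, q33⟩ := h
  -- The relation is applied to the differences of the multiplicities of x and -x; the sign of a
  -- difference shows which of the two vectors occurs in `T`.
  have o : ∀ {m n : ℕ}, 1 ≤ (m : ℤ) - n → 1 ≤ m := by omega
  have n : ∀ {m n : ℕ}, (m : ℤ) - n ≤ -1 → 1 ≤ n := by omega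
  have t : ∀ {m n : ℕ}, 2 ≤ (m : ℤ) - n → 2 ≤ m := by omega
  have m : ∀ {m n : ℕ}, (m : ℤ) - n ≤ -2 → 2 ≤ n := by omega
  have key := cube_relation_eq_zero
    (a := T.count (1, 0, 0) - T.count (-1, 0, 0))
    (b := T.count (0, 1, 0) - T.count (0, -1, 0))
    (c := T.count (0, 0, 1) - T.count (0, 0, -1))
    (d := T.count (1, 1, 0) - T.count (-1, -1, 0))
    (e := T.count (1, 0, 1) - T.count (-1, 0, -1))
    (f := T.count (0, 1, 1) - T.count (0, -1, -1))
    (g := T.count (1, 1, 1) - T.count (-1, -1, -1))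
    (by clear * - s0; linarith) (by clear * - s1; linarith) (by clear * - s2; linarith)
    (fun ⟨x, y, z⟩ => q0 (o x) (o y) (n z))
    (fun ⟨x, y, z⟩ => q1 (n x) (n y) (o z))
    (fun ⟨x, y, z⟩ => q2 (n x) (n y) (o z))
    (fun ⟨x, y, z⟩ => q3 (o x) (o y) (n z))
    (fun ⟨x, y, z⟩ => q4 (o x) (o y) (n z))
    (fun ⟨x, y, z⟩ => q5 (n x) (n y) (o z))
    (fun ⟨x, y, z⟩ => q6 (n x) (n y) (o z))
    (fun ⟨x, y, z⟩ => q7 (o x) (o y) (n z))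
    (fun ⟨x, y, z⟩ => q8 (o x) (o y) (n z))
    (fun ⟨x, y, z⟩ => q9 (n x) (n y) (o z))
    (fun ⟨x, y, z⟩ => q10 (n x) (n y) (o z))
    (fun ⟨x, y, z⟩ => q11 (o x) (o y) (n z))
    (fun ⟨x, y, z, w⟩ => q12 (o x) (n y) (n z) (o w))
    (fun ⟨x, y, z, w⟩ => q13 (n x) (o y) (o z) (n w))
    (fun ⟨x, y, z, w⟩ => q14 (o x) (n y) (n z) (o w))
    (fun ⟨x, y, z, w⟩ => q15 (n x) (o y) (o z) (n w))
    (fun ⟨x, y, z, w⟩ => q16 (o x) (n y) (n z) (o w))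
    (fun ⟨x, y, z, w⟩ => q17 (n x) (o y) (o z) (n w))
    (fun ⟨x, y, z, w⟩ => q18 (o x) (n y) (n z) (o w))
    (fun ⟨x, y, z, w⟩ => q19 (n x) (o y) (o z) (n w))
    (fun ⟨x, y, z, w⟩ => q20 (o x) (n y) (n z) (o w))
    (fun ⟨x, y, z, w⟩ => q21 (n x) (o y) (o z) (n w))
    (fun ⟨x, y, z, w⟩ => q22 (o x) (n y) (n z) (o w))
    (fun ⟨x, y, z, w⟩ => q23 (n x) (o y) (o z) (n w))
    (fun ⟨x, y, z, w⟩ => q24 (o x) (o y) (o z) (n w))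
    (fun ⟨x, y, z, w⟩ => q25 (n x) (n y) (n z) (o w))
    (fun ⟨x, y, z, w⟩ => absurd (q26 (n x) (n y) (n z)) (by have := t w; exact not_le.2 this))
    (fun ⟨x, y, z, w⟩ => absurd (q27 (o x) (o y) (o z)) (by have := m w; exact not_le.2 this))
    (fun ⟨x, y, z, w⟩ => q28 (t x) (n y) (n z) (o w))
    (fun ⟨x, y, z, w⟩ => q29 (m x) (o y) (o z) (n w))
    (fun ⟨x, y, z, w⟩ => q30 (t x) (n y) (o z) (n w))
    (fun ⟨x, y, z, w⟩ => q31 (m x) (o y) (n z) (o w))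
    (fun ⟨x, y, z, w⟩ => q32 (m x) (n y) (o z) (o w))
    (fun ⟨x, y, z, w⟩ => q33 (t x) (o y) (n z) (n w))
  -- All differences vanish, and `p0`, ..., `p6` forbid x and -x to occur together, so all
  -- multiplicities are zero.
  clear q0 q1 q2 q3 q4 q5 q6 q7 q8 q9 q10 q11 q12 q13 q14 q15 q16 q17 q18 q19 q20 q21 q22 q23 q24 q25 q26 q27 q28 q29 q30 q31 q32 q33
  refine Multiset.eq_zero_of_forall_notMem fun x hx => ?_
  have hx' := Multiset.one_le_count_iff_mem.2 hx
  have := hT x hx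
  simp only [cubeVecs3, List.mem_cons, List.not_mem_nil, or_false] at this
  rcases this with rfl | rfl | rfl | rfl | rfl | rfl | rfl | rfl | rfl | rfl | rfl | rfl | rfl | rfl <;>
    omega

theorem minimal3_ne_zero : ∀ u ∈ minimal3, u ≠ 0 ∧ u.sum = 0 := by decide

/-- The parities of the numbers of members of a multiset in `±e₁`, `±e₂`, `±e₃`, `±(e₁ + e₂ + e₃)`
detect the lengths of the minimal zero-sum multisets. -/
def parity3 (x : ℤ × ℤ × ℤ) : ZMod 2 × ZMod 2 × ZMod 2 × ZMod 2 :=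
  (if x = (1, 0, 0) ∨ x = (-1, 0, 0) then 1 else 0, if x = (0, 1, 0) ∨ x = (0, -1, 0) then 1 else 0,
    if x = (0, 0, 1) ∨ x = (0, 0, -1) then 1 else 0,
    if x = (1, 1, 1) ∨ x = (-1, -1, -1) then 1 else 0)

/-- This invariant separates the extreme lengths 2 and 5 from 3 and 4, which sharpens the bound on
`ρ_k` for odd `k`. -/
theorem parity_minimal3 : ∀ u ∈ minimal3, u.card ≤ 5 ∧
    ((u.map parity3).sum = 0 ↔ u.card = 2 ∨ u.card = 5) := by decide

/-- A minimal zero-sum multiset of length three over `cubeVecs2`. -/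
def triple2 : Multiset (ℤ × ℤ) := {(1, 1), (-1, 0), (0, -1)}

/-- A minimal zero-sum multiset of length five over `cubeVecs3`. -/
def quintuple3 : Multiset (ℤ × ℤ × ℤ) :=
  {(1, 1, 0), (1, 0, 1), (0, 1, 1), (-1, -1, -1), (-1, -1, -1)}

/-- A minimal zero-sum multiset of length four over `cubeVecs3`. -/
def quadruple3 : Multiset (ℤ × ℤ × ℤ) := {(1, 0, 0), (0, 1, 0), (0, 0, 1), (-1, -1, -1)}

/-- A minimal zero-sum multiset of length three over `cubeVecs3`. -/
def triple3 : Multiset (ℤ × ℤ × ℤ) := {(1, 0, 0), (0, 1, 0), (-1, -1, 0)}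

theorem minZeroSum_of_powerset {A : Type*} [AddCommGroup A] {u : Multiset A}
    (h : u ≠ 0 ∧ u.sum = 0 ∧ ∀ T ∈ u.powerset, T.sum = 0 → T = 0 ∨ T = u) :
    MinZeroSum (fun x : A => x) u := by
  simpa [MinZeroSum] using h

theorem minZeroSum_triple2 : MinZeroSum (fun x => x) triple2 :=
  minZeroSum_of_powerset (by decide)
theorem minZeroSum_triple3 : MinZeroSum (fun x => x) triple3 :=
  minZeroSum_of_powerset (by decide)
theorem minZeroSum_quadruple3 : MinZeroSum (fun x => x) quadruple3 :=
  minZeroSum_of_powerset (by decide)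
theorem minZeroSum_quintuple3 : MinZeroSum (fun x => x) quintuple3 :=
  minZeroSum_of_powerset (by decide)

/-- This and its rank-three analogue leave no intermediate factorizations of an extremal atom times
its negative, as the lower bound for the catenary degree requires. -/
theorem minimal2_le_triple2 : ∀ w ∈ minimal2, w ≤ triple2 + triple2.map (- ·) →
    w.card = 2 ∨ w = triple2 ∨ w = triple2.map (- ·) := by decide

theorem minimal3_le_quintuple3 : ∀ w ∈ minimal3, w ≤ quintuple3 + quintuple3.map (- ·) →
    w.card = 2 ∨ w = quintuple3 ∨ w = quintuple3.map (- ·) := by decide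

/-! ### Divisor embeddings -/

section Embedding

variable {H P A : Type*} [CancelCommMonoid H] [AddCommGroup A]

/-- An embedding `ι` of `H_red` into the free abelian monoid with basis `P`, whose image consists
of the multisets with zero sum under the weight `σ`; the weights of the members of `P` are
nonzero. -/
structure IsZeroSumModel (σ : P → A) (ι : Associates H → Multiset P) : Prop where
  map_one : ι 1 = 0
  map_mul : ∀ x y, ι (x * y) = ι x + ι y
  injective : Function.Injective ι
  mem_range : ∀ S, (∃ x, ι x = S) ↔ (S.map σ).sum = 0
  ne_zero : ∀ p, σ p ≠ 0

/-- Greedy covering: run through `z`, keeping a member only if it meets the part of `S` still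
uncovered. Each kept member removes at least one element. -/
theorem exists_le_map_sum {α : Type*} (f : α → Multiset P)
    (z : Multiset α) (S : Multiset P) (hS : S ≤ (z.map f).sum) :
    ∃ y ≤ z, y.card ≤ S.card ∧ S ≤ (y.map f).sum ∧ ∀ v ∈ y, ∃ p ∈ S, p ∈ f v := by
  classical
  induction z using Multiset.induction_on generalizing S with
  | empty => exact ⟨0, le_rfl, by simp, by simpa using hS, by simp⟩
  | cons a z ih =>
    rw [Multiset.map_cons, Multiset.sum_cons] at hS
    obtain ⟨y, hy, hc, hle, hm⟩ := ih (S - f a) (tsub_le_iff_left.2 hS)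
    by_cases hd : ∃ p ∈ S, p ∈ f a
    · refine ⟨a ::ₘ y, Multiset.cons_le_cons a hy, ?_, ?_, ?_⟩
      · obtain ⟨p, hp, hpa⟩ := hd
        have : S - f a ≤ S.erase p := by
          rw [← Multiset.sub_singleton]
          exact tsub_le_tsub_left (Multiset.singleton_le.2 hpa) S
        have := Multiset.card_le_card this
        have := Multiset.card_erase_add_one hp
        rw [Multiset.card_cons]
        omega
      · rw [Multiset.map_cons, Multiset.sum_cons]
        exact tsub_le_iff_left.1 hle
      · intro v hv
        rcases Multiset.mem_cons.1 hv with rfl | hv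
        · exact hd
        · obtain ⟨p, hp, hpv⟩ := hm v hv
          exact ⟨p, Multiset.mem_of_le tsub_le_self hp, hpv⟩
    · have : S - f a = S := by
        push Not at hd
        ext p
        by_cases hp : p ∈ S
        · simp [Multiset.count_sub, Multiset.count_eq_zero_of_notMem (hd p hp)]
        · simp [Multiset.count_sub, Multiset.count_eq_zero_of_notMem hp]
      rw [this] at hc hle hm
      exact ⟨y, hy.trans (Multiset.le_cons_self _ _), hc, hle, hm⟩

theorem dist_add_right (x y w : Multiset (Associates H)) :
    dist (x + w) (y + w) = dist x y := by
  classical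
  unfold dist
  rw [add_tsub_add_eq_tsub_right, add_tsub_add_eq_tsub_right]

theorem dist_comm (x y : Multiset (Associates H)) : dist x y = dist y x :=
  max_comm _ _

/-- `z` and `z'` are joined by a chain of factorizations of `x` with distances at most `N`. -/
def Joined (N : ℕ) (x : Associates H) (z z' : Multiset (Associates H)) : Prop :=
  Relation.ReflTransGen (fun y y' => (y ∈ factorizationMonoid H ∧ y.prod = x) ∧
    (y' ∈ factorizationMonoid H ∧ y'.prod = x) ∧ (dist y y' : ℕ∞) ≤ N) z z'

theorem Joined.symm {N : ℕ} {x : Associates H} {z z' : Multiset (Associates H)}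
    (hj : Joined N x z z') : Joined N x z' z := by
  refine Relation.ReflTransGen.mono (fun y y' hy => ?_) _ _ (Relation.ReflTransGen.swap _ _ hj)
  exact ⟨hy.2.1, hy.1, dist_comm y' y ▸ hy.2.2⟩

theorem Joined.add_right {N : ℕ} {x : Associates H}
    {z z' w : Multiset (Associates H)} (hj : Joined N x z z') (hw : w ∈ factorizationMonoid H) :
    Joined N (x * w.prod) (z + w) (z' + w) := by
  refine Relation.ReflTransGen.lift (fun y => y + w) (fun y y' hy => ?_) _ _ hj
  refine ⟨⟨?_, by simp [hy.1.2]⟩, ⟨?_, by simp [hy.2.1.2]⟩, by rw [dist_add_right]; exact hy.2.2⟩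
  · exact fun u hu => (Multiset.mem_add.1 hu).elim (hy.1.1 u) (hw u)
  · exact fun u hu => (Multiset.mem_add.1 hu).elim (hy.2.1.1 u) (hw u)

namespace IsZeroSumModel

variable {σ : P → A} {ι : Associates H → Multiset P} (h : IsZeroSumModel σ ι)

include h

theorem sum_eq_zero (x : Associates H) : ((ι x).map σ).sum = 0 :=
  (h.mem_range _).1 ⟨x, rfl⟩

theorem mul_left_cancel {x y z : Associates H} (e : x * y = x * z) : y = z :=
  h.injective (by simpa [h.map_mul] using congrArg ι e)

theorem eq_zero_iff {x : Associates H} : ι x = 0 ↔ x = 1 :=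
  ⟨fun e => h.injective (by rw [e, h.map_one]), fun e => by rw [e, h.map_one]⟩

theorem isUnit_iff {x : Associates H} : IsUnit x ↔ x = 1 := by
  refine ⟨fun hx => ?_, fun e => e ▸ isUnit_one⟩
  obtain ⟨y, hy⟩ := hx.exists_right_inv
  have := congrArg ι hy
  rw [h.map_mul, h.map_one] at this
  exact h.eq_zero_iff.1 (add_eq_zero.1 this).1

theorem map_prod (z : Multiset (Associates H)) : ι z.prod = (z.map ι).sum := by
  induction z using Multiset.induction_on with
  | empty => simp [h.map_one]
  | cons a z ih => simp [h.map_mul, ih]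

/-- The complement of a zero-sum part in a zero-sum multiset again has zero sum. Thus divisibility
in `H_red` is inclusion of multisets, and atoms are the minimal zero-sum ones. -/
theorem exists_mul_of_le {x y : Associates H} (hle : ι x ≤ ι y) : ∃ w, y = x * w := by
  obtain ⟨T, hT⟩ := Multiset.le_iff_exists_add.1 hle
  have := h.sum_eq_zero y
  rw [hT, Multiset.map_add, Multiset.sum_add, h.sum_eq_zero, zero_add] at this
  obtain ⟨w, rfl⟩ := (h.mem_range T).2 this
  exact ⟨w, h.injective (by rw [hT, h.map_mul])⟩

theorem le_of_dvd {x y : Associates H} (hd : x ∣ y) : ι x ≤ ι y := by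
  obtain ⟨w, rfl⟩ := hd
  rw [h.map_mul]
  exact Multiset.le_add_right _ _

theorem irreducible_iff {x : Associates H} : Irreducible x ↔ MinZeroSum σ (ι x) := by
  rw [_root_.irreducible_iff, MinZeroSum, h.isUnit_iff, ← h.eq_zero_iff]
  refine and_congr_right fun _ => ⟨fun hx => ⟨h.sum_eq_zero x, fun T hT h0 => ?_⟩, fun hx a b e => ?_⟩
  · obtain ⟨a, rfl⟩ := (h.mem_range T).2 h0
    obtain ⟨b, e⟩ := h.exists_mul_of_le hT
    rcases hx e with ha | hb
    · exact .inl (h.eq_zero_iff.2 (h.isUnit_iff.1 ha))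
    · rw [h.isUnit_iff.1 hb, mul_one] at e
      exact .inr (by rw [e])
  · rw [e, h.map_mul] at hx
    rcases hx.2 (ι a) (Multiset.le_add_right _ _) (h.sum_eq_zero a) with ha | ha
    · exact .inl (h.isUnit_iff.2 (h.eq_zero_iff.1 ha))
    · exact .inr (h.isUnit_iff.2 (h.eq_zero_iff.1 (by simpa using ha)))

theorem exists_irreducible {S : Multiset P} (hS : MinZeroSum σ S) :
    ∃ u, Irreducible u ∧ ι u = S := by
  obtain ⟨u, rfl⟩ := (h.mem_range S).2 hS.2.1
  exact ⟨u, h.irreducible_iff.2 hS, rfl⟩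

theorem two_le_card {u : Associates H} (hu : Irreducible u) : 2 ≤ (ι u).card := by
  have h1 := h.irreducible_iff.1 hu
  by_contra! hc
  rcases (by omega : (ι u).card = 0 ∨ (ι u).card = 1) with h0 | h0
  · exact h1.1 (Multiset.card_eq_zero.1 h0)
  · obtain ⟨p, hp⟩ := Multiset.card_eq_one.1 h0
    rw [hp] at h1
    exact h.ne_zero p (by simpa using h1.2.1)

theorem card_map_prod (z : Multiset (Associates H)) :
    (ι z.prod).card = (z.map fun u => (ι u).card).sum := by
  rw [h.map_prod]
  exact (map_multiset_sum Multiset.cardHom _).trans (by rw [Multiset.map_map]; rfl)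

theorem two_mul_card_le {z : Multiset (Associates H)} (hz : z ∈ factorizationMonoid H) :
    2 * z.card ≤ (ι z.prod).card := by
  rw [h.card_map_prod, mul_comm, ← smul_eq_mul, ← Multiset.card_map (fun u => (ι u).card) z]
  exact Multiset.card_nsmul_le_sum (by simpa using fun u hu => h.two_le_card (hz u hu))

theorem card_le_mul {D : ℕ} (hD : ∀ u, Irreducible u → (ι u).card ≤ D)
    {z : Multiset (Associates H)} (hz : z ∈ factorizationMonoid H) :
    (ι z.prod).card ≤ D * z.card := by
  rw [h.card_map_prod, mul_comm, ← smul_eq_mul, ← Multiset.card_map (fun u => (ι u).card) z]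
  exact Multiset.sum_le_card_nsmul _ _ (by simpa using fun u hu => hD u (hz u hu))

theorem exists_factorization (x : Associates H) :
    ∃ z ∈ factorizationMonoid H, z.prod = x := by
  induction hn : (ι x).card using Nat.strong_induction_on generalizing x with | _ n ih
  by_cases h1 : x = 1
  · exact ⟨0, by simp [factorizationMonoid], by simp [h1]⟩
  by_cases hx : Irreducible x
  · exact ⟨{x}, by simpa [factorizationMonoid] using hx, by simp⟩
  rw [_root_.irreducible_iff, h.isUnit_iff] at hx
  push Not at hx
  obtain ⟨a, b, rfl, ha, hb⟩ := hx h1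
  have ha' : 0 < (ι a).card := Multiset.card_pos.2 fun e => ha (h.isUnit_iff.2 (h.eq_zero_iff.1 e))
  have hb' : 0 < (ι b).card := Multiset.card_pos.2 fun e => hb (h.isUnit_iff.2 (h.eq_zero_iff.1 e))
  rw [h.map_mul, Multiset.card_add] at hn
  obtain ⟨z, hz, rfl⟩ := ih _ (by omega) a rfl
  obtain ⟨w, hw, rfl⟩ := ih _ (by omega) b rfl
  exact ⟨z + w, fun u hu => (Multiset.mem_add.1 hu).elim (hz u) (hw u), by simp⟩

theorem eq_singleton_of_prod_irreducible {z : Multiset (Associates H)}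
    (hz : z ∈ factorizationMonoid H) (hp : Irreducible z.prod) : z = {z.prod} := by
  induction z using Multiset.induction_on with
  | empty => simp at hp
  | cons a z _ =>
    have hle : ι a ≤ ι (a ::ₘ z).prod := h.le_of_dvd (by simp)
    rcases (h.irreducible_iff.1 hp).2.2 _ hle (h.sum_eq_zero a) with h0 | h0
    · exact absurd (h.eq_zero_iff.1 h0) (hz a (by simp)).ne_one
    · rw [Multiset.prod_cons, h.map_mul, left_eq_add, h.eq_zero_iff] at h0
      have := h.two_mul_card_le (z := z) fun u hu => hz u (by simp [hu])
      rw [h0, h.map_one] at this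
      have hz0 : z = 0 := Multiset.card_eq_zero.1 (by simpa using this)
      simp [hz0]

/-! ### The catenary degree -/

/-- Induction on the number of primes in `x`. Two factorizations with at most `D` factors are at
distance at most `D`; otherwise the longer one is first modified to share an atom with the other. -/
theorem joined {D : ℕ} (hD : ∀ u, Irreducible u → (ι u).card ≤ D)
    (x : Associates H) {z z' : Multiset (Associates H)} (hz : z ∈ factorizationMonoid H)
    (hz' : z' ∈ factorizationMonoid H) (hx : z.prod = x) (hx' : z'.prod = x) :
    Joined D x z z' := by
  classical
  induction hn : (ι x).card using Nat.strong_induction_on generalizing x z z' with | _ n ih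
  have main : ∀ z z' : Multiset (Associates H), z ∈ factorizationMonoid H →
      z' ∈ factorizationMonoid H → z.prod = x → z'.prod = x → D < z.card → Joined D x z z' := by
    intro z z' hz hz' hx hx' hlt
    have hpos := h.two_mul_card_le hz
    obtain ⟨u, hu⟩ : ∃ u, u ∈ z' := by
      refine Multiset.exists_mem_of_ne_zero fun h0 => ?_
      rw [hx, ← hx', h0, Multiset.prod_zero, h.map_one, Multiset.card_zero] at hpos
      omega
    obtain ⟨z₁, rfl⟩ := Multiset.exists_cons_of_mem hu
    have hz₁ : z₁ ∈ factorizationMonoid H := fun v hv => hz' v (Multiset.mem_cons_of_mem hv)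
    have hui := hz' u hu
    obtain ⟨y, hy, hc, hle, -⟩ := exists_le_map_sum ι z (ι u) (by
      rw [← h.map_prod, hx, ← hx']
      exact h.le_of_dvd (by simp))
    obtain ⟨t, rfl⟩ := Multiset.le_iff_exists_add.1 hy
    have hym : y ∈ factorizationMonoid H := fun v hv => hz v (by simp [hv])
    have htm : t ∈ factorizationMonoid H := fun v hv => hz v (by simp [hv])
    rw [← h.map_prod] at hle
    obtain ⟨w, hw⟩ := h.exists_mul_of_le hle
    obtain ⟨w, hwm, rfl⟩ := h.exists_factorization w
    have hDu := hD u hui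
    have huw : u ::ₘ w ∈ factorizationMonoid H := fun v hv => by
      rcases Multiset.mem_cons.1 hv with rfl | hv
      exacts [hui, hwm v hv]
    rw [Multiset.prod_add] at hx
    have hn' : (ι y.prod).card + (ι t.prod).card = n := by
      rw [← hn, ← hx, h.map_mul, Multiset.card_add]
    have ht := h.two_mul_card_le htm
    rw [Multiset.card_add] at hlt
    -- Here `y` has at most `D` factors, so `t` is nonempty and `y.prod` has fewer primes than `x`.
    have h1 : Joined D x (y + t) (u ::ₘ w + t) := by
      rw [← hx]
      exact (ih _ (by omega) y.prod hym huw rfl (by simp [hw]) rfl).add_right htm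
    have hn'' : (ι u).card + (ι z₁.prod).card = n := by
      rw [← hn, ← hx', Multiset.prod_cons, h.map_mul, Multiset.card_add]
    have hu2 := h.two_le_card hui
    -- Both factorizations contain `u`; cancelling it leaves a smaller element.
    have h2 : Joined D x (u ::ₘ w + t) (u ::ₘ z₁) := by
      have hprod : (w + t).prod = z₁.prod := h.mul_left_cancel (x := u) (by
        rw [← Multiset.prod_cons u z₁, hx', ← hx, hw, Multiset.prod_add, mul_assoc])
      have := (ih _ (by omega) z₁.prod (z := w + t)
        (fun v hv => (Multiset.mem_add.1 hv).elim (hwm v) (htm v)) hz₁ hprod rfl rfl).add_right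
        (w := {u}) (by simpa [factorizationMonoid] using hui)
      simpa [← hx', add_comm _ ({u} : Multiset (Associates H)), Multiset.singleton_add,
        mul_comm] using this
    exact h1.trans h2
  rcases lt_or_ge D z.card with h1 | h1
  · exact main z z' hz hz' hx hx' h1
  rcases lt_or_ge D z'.card with h2 | h2
  · exact (main z' z hz' hz hx' hx h2).symm
  refine Relation.ReflTransGen.single ⟨⟨hz, hx⟩, ⟨hz', hx'⟩, ?_⟩
  unfold dist
  have h3 := Multiset.card_le_card (tsub_le_self : z - z' ≤ z)
  have h4 := Multiset.card_le_card (tsub_le_self : z' - z ≤ z')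
  exact_mod_cast max_le (h3.trans h1) (h4.trans h2)

theorem catenaryDegree_le {D : ℕ} (hD : ∀ u, Irreducible u → (ι u).card ≤ D) :
    catenaryDegree H ≤ D :=
  iSup_le fun a => sInf_le fun _ hz _ hz' => h.joined hD (Associates.mk a) hz.1 hz'.1 hz.2 hz'.2

/-- A factorization into two atoms shares no atom with any other one, since the cofactor would be
irreducible. Leaving `z` therefore costs the full length of the next factorization. -/
theorem le_catenaryDegreeOf {n : ℕ} {a : H} {z z' : Multiset (Associates H)}
    (hz : z ∈ factorizations a) (hz' : z' ∈ factorizations a) (hc : z.card = 2) (hne : z ≠ z')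
    (hn : ∀ y ∈ factorizations a, y ≠ z → n ≤ y.card) : (n : ℕ∞) ≤ catenaryDegreeOf a := by
  classical
  refine le_sInf fun N hN => ?_
  by_contra! hlt
  apply hne
  have key := hN z hz z' hz'
  -- The end of the chain must be arbitrary: induction shows that every member of the chain equals
  -- `z`.
  clear hne hz'
  induction key with
  | refl => rfl
  | @tail b c _ hbc ih =>
    obtain ⟨hb, hc', hd⟩ := hbc
    subst ih
    by_contra hcb
    have hdisj : ∀ v ∈ z, v ∉ c := by
      intro v hvb hvc
      obtain ⟨z₁, rfl⟩ := Multiset.exists_cons_of_mem hvb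
      obtain ⟨c₁, rfl⟩ := Multiset.exists_cons_of_mem hvc
      obtain ⟨w, rfl⟩ := Multiset.card_eq_one.1 (by simpa using hc : z₁.card = 1)
      have hp := hb.2.trans hc'.2.symm
      rw [Multiset.prod_cons, Multiset.prod_cons] at hp
      have hp := h.mul_left_cancel hp
      rw [Multiset.prod_singleton] at hp
      refine hcb ?_
      rw [h.eq_singleton_of_prod_irreducible (z := c₁) (fun t ht => hc'.1 t (by simp [ht]))
        (hp ▸ hb.1 w (by simp)), ← hp]
    have hle : c.card ≤ dist z c := by
      have : c - z = c := by
        ext p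
        by_cases hp : p ∈ z
        · simp [Multiset.count_sub, Multiset.count_eq_zero_of_notMem (hdisj p hp)]
        · simp [Multiset.count_sub, Multiset.count_eq_zero_of_notMem hp]
      refine le_trans ?_ (le_max_right _ _)
      convert le_rfl
    have h1 := hn c hc' (Ne.symm hcb)
    exact absurd (hd.trans_lt hlt) (not_lt.2 (by exact_mod_cast h1.trans hle))

end IsZeroSumModel

end Embedding

/-! ### Unions of sets of lengths -/

section Unions

variable {H : Type*} [CancelCommMonoid H]

theorem mem_unionLengths_iff {u : Associates H} (hu : Irreducible u) {k l : ℕ} :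
    l ∈ unionLengths H k ↔ ∃ z ∈ factorizationMonoid H, ∃ z' ∈ factorizationMonoid H,
      z.prod = z'.prod ∧ z.card = k ∧ z'.card = l := by
  have hng : ¬ ∀ a : H, IsUnit a := fun hg => by
    obtain ⟨a, rfl⟩ := Associates.mk_surjective u
    exact hu.not_isUnit (Associates.isUnit_mk.2 (hg a))
  rw [unionLengths, if_neg hng]
  constructor
  · rintro ⟨a, ⟨z, hz, rfl⟩, ⟨z', hz', rfl⟩⟩
    exact ⟨z, hz.1, z', hz'.1, hz.2.trans hz'.2.symm, rfl, rfl⟩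
  · rintro ⟨z, hz, z', hz', e, rfl, rfl⟩
    obtain ⟨a, ha⟩ := Associates.mk_surjective z.prod
    exact ⟨a, ⟨z, ⟨hz, ha.symm⟩, rfl⟩, ⟨z', ⟨hz', (ha.trans e).symm⟩, rfl⟩⟩

variable {u : Associates H} (hu : Irreducible u)

include hu

theorem mem_unionLengths_comm {k l : ℕ} : l ∈ unionLengths H k ↔ k ∈ unionLengths H l := by
  rw [mem_unionLengths_iff hu, mem_unionLengths_iff hu]
  constructor <;> exact fun ⟨z, hz, z', hz', e, h1, h2⟩ => ⟨z', hz', z, hz, e.symm, h2, h1⟩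

theorem add_mem_unionLengths {k l k' l' : ℕ} (h : l ∈ unionLengths H k)
    (h' : l' ∈ unionLengths H k') : l + l' ∈ unionLengths H (k + k') := by
  rw [mem_unionLengths_iff hu] at *
  obtain ⟨z, hz, y, hy, e, rfl, rfl⟩ := h
  obtain ⟨z', hz', y', hy', e', rfl, rfl⟩ := h'
  exact ⟨z + z', fun v hv => (Multiset.mem_add.1 hv).elim (hz v) (hz' v), y + y',
    fun v hv => (Multiset.mem_add.1 hv).elim (hy v) (hy' v), by simp [e, e'], by simp, by simp⟩

theorem self_mem_unionLengths (k : ℕ) : k ∈ unionLengths H k :=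
  (mem_unionLengths_iff hu).2 ⟨Multiset.replicate k u,
    fun v hv => Multiset.eq_of_mem_replicate hv ▸ hu, Multiset.replicate k u,
    fun v hv => Multiset.eq_of_mem_replicate hv ▸ hu, rfl, by simp, by simp⟩

/-- The bound `hub` is attained by adding elements of U_2, and every value between `k` and the bound
is reached in the same way. Smaller values come from symmetry in `k` and `l`. -/
theorem isInterval_unionLengths_and_rho {D : ℕ} (hD : 2 ≤ D)
    (h2 : ∀ n, 2 ≤ n → n ≤ D → n ∈ unionLengths H 2)
    (hub : ∀ k, ∀ l ∈ unionLengths H k, l ≤ D * (k / 2) + k % 2) :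
    (∀ k, 2 ≤ k → IsInterval (unionLengths H k)) ∧
      ∀ k, 2 ≤ k → ∀ j ≤ 1, rho H (2 * k + j) = ((D * k + j : ℕ) : ℕ∞) := by
  have hlb : ∀ k l, k ≤ l → l ≤ D * (k / 2) + k % 2 → l ∈ unionLengths H k := by
    intro k
    induction k using Nat.twoStepInduction with
    | zero =>
      intro l _ hl
      obtain rfl : l = 0 := by simpa using hl
      exact self_mem_unionLengths hu 0
    | one =>
      intro l h1 hl
      obtain rfl : l = 1 := by simp at hl; omega
      exact self_mem_unionLengths hu 1
    | more k ih _ =>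
      intro l h1 hl
      have e : D * ((k + 2) / 2) = D * (k / 2) + D := by
        rw [Nat.add_div_right k two_pos, Nat.mul_succ]
      have hk : k ≤ D * (k / 2) + k % 2 := by
        have := Nat.mul_le_mul_right (k / 2) hD
        omega
      -- As much of the excess `l - k` as U_2 allows is taken from the two new factors.
      have key := add_mem_unionLengths hu (ih (l - min D (l - k)) (by omega) (by omega))
        (h2 (min D (l - k)) (by omega) (by omega))
      rwa [show l - min D (l - k) + min D (l - k) = l by omega] at key
  have hself : ∀ k, k ≤ D * (k / 2) + k % 2 := fun k => hub k k (self_mem_unionLengths hu k)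
  have hmono : ∀ k l, k ≤ l → D * (k / 2) + k % 2 ≤ D * (l / 2) + l % 2 := by
    intro k l hkl
    rcases (Nat.div_le_div_right hkl : k / 2 ≤ l / 2).eq_or_lt with e | hlt
    · rw [e]; omega
    · have := Nat.mul_le_mul_left D (Nat.succ_le_of_lt hlt)
      rw [Nat.mul_succ] at this
      omega
  have hIcc : ∀ k, unionLengths H k =
      Set.Icc (sInf (unionLengths H k)) (D * (k / 2) + k % 2) := by
    intro k
    refine Set.Subset.antisymm (fun l hl => ⟨Nat.sInf_le hl, hub k l hl⟩) fun l hl => ?_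
    rcases le_or_gt k l with hkl | hkl
    · exact hlb k l hkl hl.2
    -- With m the minimum of U_k, symmetry puts `k` into U_m, so `k` is at most the bound for m,
    -- hence at most the bound for `l`.
    · have hm := Nat.sInf_mem ⟨k, self_mem_unionLengths hu k⟩
      have := hub _ _ ((mem_unionLengths_comm hu).1 hm)
      exact (mem_unionLengths_comm hu).1 (hlb l k hkl.le (this.trans (hmono _ _ hl.1)))
  refine ⟨fun k _ => ⟨_, _, ?_, hIcc k⟩, fun k _ j hj => ?_⟩
  · exact (Nat.sInf_le (self_mem_unionLengths hu k)).trans (hself k)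
  · have e : D * ((2 * k + j) / 2) + (2 * k + j) % 2 = D * k + j := by
      rw [show (2 * k + j) / 2 = k by omega, show (2 * k + j) % 2 = j by omega]
    have h1 := hub (2 * k + j)
    have h3 := hself (2 * k + j)
    have h4 := hlb (2 * k + j) _ h3 le_rfl
    rw [e] at h1 h3 h4
    refine le_antisymm (iSup₂_le fun l hl => by exact_mod_cast h1 l hl) ?_
    exact le_iSup₂_of_le (D * k + j) h4 le_rfl

end Unions

/-- With total defect 1, exactly one factor has defect 1 and contributes a nonzero value, while all
the others contribute zero. -/
theorem sum_map_of_defect {α B : Type*} [AddCommMonoid B] (d : α → ℕ) (χ : α → B)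
    (z : Multiset α) (h0 : ∀ v ∈ z, d v = 0 → χ v = 0) (h1 : ∀ v ∈ z, d v = 1 → χ v ≠ 0) :
    ((z.map d).sum = 0 → (z.map χ).sum = 0) ∧ ((z.map d).sum = 1 → (z.map χ).sum ≠ 0) := by
  induction z using Multiset.induction_on with
  | empty => simp
  | cons a z ih =>
    obtain ⟨i0, i1⟩ := ih (fun v hv => h0 v (by simp [hv])) fun v hv => h1 v (by simp [hv])
    have a0 := h0 a (by simp)
    have a1 := h1 a (by simp)
    simp only [Multiset.map_cons, Multiset.sum_cons]
    refine ⟨fun e => ?_, fun e => ?_⟩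
    · rw [a0 (by omega), i0 (by omega), zero_add]
    · rcases (by omega : d a = 0 ∧ (z.map d).sum = 1 ∨ d a = 1 ∧ (z.map d).sum = 0)
        with ⟨e1, e2⟩ | ⟨e1, e2⟩
      · rw [a0 e1, zero_add]; exact i1 e2
      · rw [i0 e2, add_zero]; exact a1 e1

theorem sum_map_sub_add {α : Type*} (f g : α → ℕ) (z : Multiset α) (hfg : ∀ v ∈ z, f v ≤ g v) :
    (z.map fun v => g v - f v).sum + (z.map f).sum = (z.map g).sum := by
  rw [← Multiset.sum_map_add]
  exact congrArg _ (Multiset.map_congr rfl fun v hv => Nat.sub_add_cancel (hfg v hv))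

theorem minZeroSum_congr {P A : Type*} [AddCommGroup A] {σ τ : P → A} {S : Multiset P}
    (h : ∀ p ∈ S, σ p = τ p) (hS : MinZeroSum σ S) : MinZeroSum τ S := by
  have key : ∀ T ≤ S, T.map σ = T.map τ := fun T hT =>
    Multiset.map_congr rfl fun p hp => h p (Multiset.mem_of_le hT hp)
  exact ⟨hS.1, key S le_rfl ▸ hS.2.1, fun T hT h0 => hS.2.2 T hT (by rw [key T hT, h0])⟩

/-! ### The product of an atom and its negative -/

namespace IsZeroSumModel

variable {H P A : Type*} [CancelCommMonoid H] [AddCommGroup A]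
variable {σ : P → A} {ι : Associates H → Multiset P} (h : IsZeroSumModel σ ι)

include h

/-- The map `s` picks one prime for each weight in `u` and `-u`, so the primes of `U * U'` regroup
into the pairs `{s x, s (-x)}`. -/
theorem exists_symmetric {s : A → P} {u : Multiset A} (hu : MinZeroSum (fun x => x) u)
    (hs : ∀ x ∈ u, σ (s x) = x) (hs' : ∀ x ∈ u, σ (s (-x)) = -x) :
    ∃ U U' : Associates H, Irreducible U ∧ Irreducible U' ∧ ι U = u.map s ∧
      ι U' = u.map (fun x => s (-x)) ∧ ∃ z ∈ factorizationMonoid H,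
        (∀ v ∈ z, (ι v).card = 2) ∧ z.card = u.card ∧ z.prod = U * U' := by
  have h1 : MinZeroSum σ (u.map s) :=
    (minZeroSum_map σ s u).2 (minZeroSum_congr (fun x hx => (hs x hx).symm) hu)
  have h2 : MinZeroSum σ (u.map fun x => s (-x)) :=
    (minZeroSum_map σ (fun x => s (-x)) u).2 (minZeroSum_congr (fun x hx => (hs' x hx).symm)
      ((minZeroSum_comp_iff (fun x : A => x) (-AddMonoidHom.id A)
        (fun a b hab => neg_injective hab) u).2 hu))
  obtain ⟨U, hU, eU⟩ := h.exists_irreducible h1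
  obtain ⟨U', hU', eU'⟩ := h.exists_irreducible h2
  have h3 : ∀ x ∈ u, ∃ v : Associates H, Irreducible v ∧ ι v = {s x, s (-x)} := fun x hx =>
    h.exists_irreducible (minZeroSum_pair (h.ne_zero _) (by rw [hs x hx, hs' x hx, add_neg_cancel]))
  choose! f hf hf' using h3
  refine ⟨U, U', hU, hU', eU, eU', u.map f, ?_, ?_, by simp, h.injective ?_⟩
  · intro v hv
    obtain ⟨x, hx, rfl⟩ := Multiset.mem_map.1 hv
    exact hf x hx
  · intro v hv
    obtain ⟨x, hx, rfl⟩ := Multiset.mem_map.1 hv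
    rw [hf' x hx]
    rfl
  · rw [h.map_prod, h.map_mul, eU, eU', Multiset.map_map]
    have e : ∀ x ∈ u, (ι ∘ f) x = {s x} + {s (-x)} := fun x hx => hf' x hx
    have e' : ∀ g : A → P, (u.map fun x => ({g x} : Multiset P)).sum = u.map g := fun g => by
      rw [← Multiset.sum_map_singleton (u.map g), Multiset.map_map]
      rfl
    rw [Multiset.map_congr rfl e, Multiset.sum_map_add, e', e']

theorem card_mem_unionLengths {s : A → P} {u : Multiset A} (hu : MinZeroSum (fun x => x) u)
    (hs : ∀ x ∈ u, σ (s x) = x) (hs' : ∀ x ∈ u, σ (s (-x)) = -x) :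
    u.card ∈ unionLengths H 2 := by
  obtain ⟨U, U', hU, hU', -, -, z, hz, -, hc, hp⟩ := h.exists_symmetric hu hs hs'
  exact (mem_unionLengths_iff hU).2 ⟨{U, U'}, by
    simpa [factorizationMonoid] using ⟨hU, hU'⟩, z, hz, by simp [hp], rfl, hc⟩

theorem le_catenaryDegree {L : List (Multiset A)}
    (hL : ∀ u, Irreducible u → (ι u).map σ ∈ L)
    {s : A → P} {u : Multiset A} (hu : MinZeroSum (fun x => x) u)
    (hs : ∀ x ∈ u, σ (s x) = x) (hs' : ∀ x ∈ u, σ (s (-x)) = -x) (h3 : 3 ≤ u.card)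
    (hLu : ∀ w ∈ L, w ≤ u + u.map (- ·) → w.card = 2 ∨ w = u ∨ w = u.map (- ·)) :
    (u.card : ℕ∞) ≤ catenaryDegree H := by
  obtain ⟨U, U', hU, hU', eU, eU', z, hz, h2, hc, hp⟩ := h.exists_symmetric hu hs hs'
  obtain ⟨a, ha⟩ := Associates.mk_surjective (U * U')
  refine le_trans ?_ (le_iSup catenaryDegreeOf a)
  refine h.le_catenaryDegreeOf (z := {U, U'}) (z' := z) ⟨?_, by simp [ha]⟩ ⟨hz, hp.trans ha.symm⟩
    rfl (fun e => ?_) fun y hy hne => ?_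
  · simpa [factorizationMonoid] using ⟨hU, hU'⟩
  · rw [← e] at hc
    have : Multiset.card ({U, U'} : Multiset (Associates H)) = 2 := rfl
    omega
  have hyp : y.prod = U * U' := hy.2.trans ha
  have hatom : ∀ v ∈ y, (ι v).card = 2 ∨ v = U ∨ v = U' := by
    intro v hv
    have hle := h.le_of_dvd (Multiset.dvd_prod hv)
    rw [hyp, h.map_mul, eU, eU'] at hle
    -- All primes below `U * U'` are values of `s`, so a divisor is determined by its weights.
    have hsec : ∀ p ∈ ι v, s (σ p) = p := by
      intro p hpv
      rcases Multiset.mem_add.1 (Multiset.mem_of_le hle hpv) with hq | hq <;>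
        obtain ⟨x, hx, rfl⟩ := Multiset.mem_map.1 hq
      · rw [hs x hx]
      · rw [hs' x hx]
    have hback : ((ι v).map σ).map s = ι v := by
      rw [Multiset.map_map]
      exact (Multiset.map_congr rfl hsec).trans (Multiset.map_id' _)
    have hle' := Multiset.map_le_map (f := σ) hle
    simp only [Multiset.map_add, Multiset.map_map, Function.comp_def] at hle'
    rw [Multiset.map_congr rfl (g := fun x => x) hs, Multiset.map_id',
      Multiset.map_congr rfl (g := fun x => -x) hs'] at hle'
    rcases hLu _ (hL v (hy.1 v hv)) hle' with e | e | e
    · exact .inl (by simpa using e)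
    · exact .inr (.inl (h.injective (by rw [← hback, e, eU])))
    · exact .inr (.inr (h.injective (by rw [← hback, e, eU', Multiset.map_map]; rfl)))
  have hpair : ∀ V V', Irreducible V' → y.prod = V * V' → V ∈ y → y = {V, V'} := by
    intro V V' hV' e hV
    obtain ⟨y₁, rfl⟩ := Multiset.exists_cons_of_mem hV
    rw [Multiset.prod_cons] at e
    have e := h.mul_left_cancel e
    rw [h.eq_singleton_of_prod_irreducible (z := y₁) (fun t ht => hy.1 t (by simp [ht])) (e ▸ hV'),
      e]
    rfl
  have hall : ∀ v ∈ y, (ι v).card = 2 := by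
    intro v hv
    rcases hatom v hv with e | rfl | rfl
    · exact e
    · exact absurd (hpair v U' hU' hyp hv) hne
    · exact absurd ((hpair v U hU (hyp.trans (mul_comm _ _)) hv).trans (Multiset.pair_comm _ _)) hne
  -- Counting primes: `2 * y.card = 2 * u.card`.
  have e1 := h.card_map_prod y
  rw [hyp, h.map_mul, Multiset.card_add, eU, eU', Multiset.card_map, Multiset.card_map,
    Multiset.map_congr rfl hall, Multiset.map_const', Multiset.sum_replicate, smul_eq_mul] at e1
  omega

end IsZeroSumModel

namespace IsZeroSumModel

variable {H P : Type*} [CancelCommMonoid H]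

theorem sum_map_prod {A B : Type*} [AddCommGroup A] [AddCommMonoid B] {σ : P → A}
    {ι : Associates H → Multiset P} (h : IsZeroSumModel σ ι) (χ : A → B)
    (z : Multiset (Associates H)) : (((ι z.prod).map σ).map χ).sum =
      (z.map fun v => (((ι v).map σ).map χ).sum).sum := by
  rw [h.map_prod]
  induction z using Multiset.induction_on with
  | empty => simp
  | cons a z ih => simp only [Multiset.map_cons, Multiset.sum_cons, Multiset.map_add,
      Multiset.sum_add, ih]

/-! ### Rank two -/

section RankTwo

variable {σ : P → ℤ × ℤ} {ι : Associates H → Multiset P} (h : IsZeroSumModel σ ι)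
  (hσ : ∀ p, σ p ∈ cubeVecs2)

include h hσ

theorem map_mem_minimal2 (u : Associates H) (hu : Irreducible u) : (ι u).map σ ∈ minimal2 :=
  MinZeroSum.map_mem minimal2_ne_zero exists_minimal2_le (fun p _ => hσ p) (h.irreducible_iff.1 hu)

theorem card_le_three (u : Associates H) (hu : Irreducible u) : (ι u).card ≤ 3 := by
  have : ∀ w ∈ minimal2, w.card ≤ 3 := by decide
  simpa using this _ (h.map_mem_minimal2 hσ u hu)

theorem le_of_mem_unionLengths_two {u : Associates H} (hu : Irreducible u) (k l : ℕ)
    (hl : l ∈ unionLengths H k) : l ≤ 3 * (k / 2) + k % 2 := by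
  obtain ⟨z, hz, y, hy, e, rfl, rfl⟩ := (mem_unionLengths_iff hu).1 hl
  have h1 := h.card_le_mul (h.card_le_three hσ) hz
  have h2 := h.two_mul_card_le hy
  rw [← e] at h2
  omega

theorem tameDegree_le_three : tameDegree H ≤ 3 := by
  refine iSup_le fun ⟨u, hu⟩ => sInf_le fun z hz hdvd _ => ?_
  obtain ⟨y, hy, hc, hle, hm⟩ := exists_le_map_sum ι z (ι u) (by
    rw [← h.map_prod]
    exact h.le_of_dvd hdvd)
  have hyf : y ∈ factorizationMonoid H := fun v hv => hz v (Multiset.mem_of_le hy hv)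
  rw [← h.map_prod] at hle
  obtain ⟨w, hw⟩ := h.exists_mul_of_le hle
  obtain ⟨w, hwf, rfl⟩ := h.exists_factorization w
  refine ⟨y, hy, w, hwf, hw, ?_⟩
  have hu3 := h.card_le_three hσ u hu
  have hu2 := h.two_le_card hu
  suffices hw2 : w.card ≤ 2 by
    have : max (w.card + 1) y.card ≤ 3 := max_le (by omega) (by omega)
    exact_mod_cast this
  -- Now 6 ≤ 2|w| ≤ 3|y| - |u| ≤ 2|u| ≤ 6, so equality holds throughout: `u` and the three members
  -- of `y` have three primes each, and `w` consists of three pairs.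
  by_contra! hlt
  have e := congrArg (fun x => (ι x).card) hw
  simp only [h.map_mul, Multiset.card_add] at e
  have h1 := h.card_le_mul (h.card_le_three hσ) hyf
  have h2 := h.two_mul_card_le hwf
  have hu : (ι u).card = 3 := by omega
  have hy3 : ∀ v ∈ y, (ι v).card = 3 := by
    have key := sum_map_sub_add (fun v => (ι v).card) (fun _ => 3) y
      fun v hv => h.card_le_three hσ v (hyf v hv)
    rw [Multiset.map_const', Multiset.sum_replicate, smul_eq_mul, ← h.card_map_prod] at key
    have h0 := Multiset.sum_eq_zero_iff.1 (Nat.eq_zero_of_le_zero (by omega :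
      (y.map fun v => 3 - (ι v).card).sum ≤ 0))
    intro v hv
    have := h0 _ (Multiset.mem_map_of_mem _ hv)
    have := h.card_le_three hσ v (hyf v hv)
    omega
  have hw2 : ∀ v ∈ w, (ι v).card = 2 := by
    have key := sum_map_sub_add (fun _ => 2) (fun v => (ι v).card) w
      fun v hv => h.two_le_card (hwf v hv)
    rw [Multiset.map_const', Multiset.sum_replicate, smul_eq_mul, ← h.card_map_prod] at key
    have h0 := Multiset.sum_eq_zero_iff.1 (Nat.eq_zero_of_le_zero (by omega :
      (w.map fun v => (ι v).card - 2).sum ≤ 0))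
    intro v hv
    have := h0 _ (Multiset.mem_map_of_mem _ hv)
    have := h.two_le_card (hwf v hv)
    omega
  -- This character vanishes on pairs and is ±1 on triples. The two triples of weights are disjoint,
  -- so every member of `y`, meeting `u`, has the weights of `u`; hence 3Ψ(u) = Ψ(u), which is
  -- absurd.
  let ψ : ℤ × ℤ → ℤ := fun x => if x = (1, 1) then 1 else if x = (-1, -1) then -1 else 0
  let Ψ : Associates H → ℤ := fun x => (((ι x).map σ).map ψ).sum
  have hΨ : ∀ z : Multiset (Associates H), Ψ z.prod = (z.map Ψ).sum :=
    h.sum_map_prod _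
  have hΨmul : ∀ x x', Ψ (x * x') = Ψ x + Ψ x' := by simp [Ψ, h.map_mul]
  have hpair : ∀ a ∈ minimal2, a.card = 2 → (a.map ψ).sum = 0 := by decide
  have htriple : ∀ a ∈ minimal2, a.card = 3 → (a.map ψ).sum ≠ 0 := by decide
  have hshare : ∀ a ∈ minimal2, ∀ b ∈ minimal2, a.card = 3 → b.card = 3 →
      ∀ p ∈ a, p ∈ b → b = a := by decide
  have huL := h.map_mem_minimal2 hσ u ‹_›
  have hΨy : ∀ v ∈ y, Ψ v = Ψ u := by
    intro v hv
    obtain ⟨p, hp, hpv⟩ := hm v hv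
    have := hshare _ huL _ (h.map_mem_minimal2 hσ v (hyf v hv)) (by simpa using hu)
      (by simpa using hy3 v hv) (σ p)
      (Multiset.mem_map_of_mem σ hp) (Multiset.mem_map_of_mem σ hpv)
    simp only [Ψ, this]
  have hΨw : ∀ v ∈ w, Ψ v = 0 := fun v hv =>
    hpair _ (h.map_mem_minimal2 hσ v (hwf v hv)) (by simpa using hw2 v hv)
  have hΨu : Ψ u ≠ 0 := htriple _ huL (by simpa using hu)
  have e' := congrArg Ψ hw
  rw [hΨmul, hΨ, hΨ, Multiset.map_congr rfl hΨy, Multiset.map_congr rfl hΨw] at e'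
  simp only [Multiset.map_const', Multiset.sum_replicate, smul_zero, add_zero,
    show y.card = 3 by omega] at e'
  simp only [nsmul_eq_mul, Nat.cast_ofNat] at e'
  omega

theorem three_le_tameDegree {s : ℤ × ℤ → P} (hs : ∀ x ∈ cubeVecs2, σ (s x) = x) :
    3 ≤ tameDegree H := by
  obtain ⟨U, U', hU, hU', eU, -, z, hz, h2, hc, hp⟩ := h.exists_symmetric minZeroSum_triple2
    (fun x hx => hs x ((by decide : ∀ x ∈ triple2, x ∈ cubeVecs2) x hx))
    (fun x hx => hs _ ((by decide : ∀ x ∈ triple2, -x ∈ cubeVecs2) x hx))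
  refine le_trans ?_ (le_iSup (fun u : {u : Associates H // Irreducible u} =>
    localTameDegree u.1) ⟨U, hU⟩)
  have hU3 : (ι U).card = 3 := by rw [eU]; rfl
  refine le_sInf fun N hN => ?_
  obtain ⟨y, hy, w, hw, e, hle⟩ := hN z hz (hp ▸ dvd_mul_right _ _) fun hUz => by
    have := h2 U hUz
    omega
  refine le_trans ?_ hle
  have e1 := congrArg (fun x => (ι x).card) e
  simp only [h.map_mul, Multiset.card_add] at e1
  rw [h.card_map_prod, Multiset.map_congr rfl (fun v hv => h2 v (Multiset.mem_of_le hy hv)),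
    Multiset.map_const', Multiset.sum_replicate, smul_eq_mul, hU3] at e1
  have h4 := h.two_mul_card_le hw
  have h5 := h.card_le_mul (h.card_le_three hσ) hw
  -- If `y` had at most two pairs, `w.prod` would consist of a single prime, which is impossible.
  have : 3 ≤ max (w.card + 1) y.card := le_max_of_le_right (by omega)
  exact_mod_cast this

theorem rank_two {s : ℤ × ℤ → P} (hs : ∀ x ∈ cubeVecs2, σ (s x) = x) :
    catenaryDegree H = 3 ∧ tameDegree H = 3 ∧
      (∀ k : ℕ, 2 ≤ k → IsInterval (unionLengths H k)) ∧
      ∀ k : ℕ, 2 ≤ k → ∀ j : ℕ, j ≤ 1 → rho H (2 * k + j) = ((3 * k + j : ℕ) : ℕ∞) := by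
  have h1 : ∀ x ∈ triple2, σ (s x) = x := fun x hx =>
    hs x ((by decide : ∀ x ∈ triple2, x ∈ cubeVecs2) x hx)
  have h2 : ∀ x ∈ triple2, σ (s (-x)) = -x := fun x hx =>
    hs _ ((by decide : ∀ x ∈ triple2, -x ∈ cubeVecs2) x hx)
  obtain ⟨u, -, hu, -⟩ := h.exists_symmetric minZeroSum_triple2 h1 h2
  refine ⟨le_antisymm (h.catenaryDegree_le (h.card_le_three hσ)) ?_,
    le_antisymm (h.tameDegree_le_three hσ) (h.three_le_tameDegree hσ hs),
    isInterval_unionLengths_and_rho hu (by norm_num) (fun n hn hn' => ?_)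
      (h.le_of_mem_unionLengths_two hσ hu)⟩
  · exact h.le_catenaryDegree (h.map_mem_minimal2 hσ) minZeroSum_triple2 h1 h2 (by decide)
      minimal2_le_triple2
  · rcases (by omega : n = 2 ∨ n = 3) with rfl | rfl
    · exact self_mem_unionLengths hu 2
    · exact h.card_mem_unionLengths minZeroSum_triple2 h1 h2

end RankTwo

/-! ### Rank three -/

section RankThree

variable {σ : P → ℤ × ℤ × ℤ} {ι : Associates H → Multiset P} (h : IsZeroSumModel σ ι)
  (hσ : ∀ p, σ p ∈ cubeVecs3)

include h hσ

theorem map_mem_minimal3 (u : Associates H) (hu : Irreducible u) : (ι u).map σ ∈ minimal3 :=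
  MinZeroSum.map_mem minimal3_ne_zero exists_minimal3_le (fun p _ => hσ p) (h.irreducible_iff.1 hu)

theorem card_le_five (u : Associates H) (hu : Irreducible u) : (ι u).card ≤ 5 := by
  simpa using (parity_minimal3 _ (h.map_mem_minimal3 hσ u hu)).1

theorem le_of_mem_unionLengths_three {u : Associates H} (hu : Irreducible u) (k l : ℕ)
    (hl : l ∈ unionLengths H k) : l ≤ 5 * (k / 2) + k % 2 := by
  obtain ⟨z, hz, y, hy, e, rfl, rfl⟩ := (mem_unionLengths_iff hu).1 hl
  by_contra! hlt
  have h1 := h.card_le_mul (h.card_le_five hσ) hz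
  have h2 := h.two_mul_card_le hy
  have key1 := sum_map_sub_add (fun v => (ι v).card) (fun _ => 5) z
    fun v hv => h.card_le_five hσ v (hz v hv)
  have key2 := sum_map_sub_add (fun _ => 2) (fun v => (ι v).card) y
    fun v hv => h.two_le_card (hy v hv)
  rw [Multiset.map_const', Multiset.sum_replicate, smul_eq_mul, ← h.card_map_prod] at key1 key2
  let Ψ : Associates H → ZMod 2 × ZMod 2 × ZMod 2 × ZMod 2 :=
    fun x => (((ι x).map σ).map parity3).sum
  have hΨ : ∀ z : Multiset (Associates H), Ψ z.prod = (z.map Ψ).sum :=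
    h.sum_map_prod _
  have hpar : ∀ v, Irreducible v → (Ψ v = 0 ↔ (ι v).card = 2 ∨ (ι v).card = 5) := fun v hv => by
    have := (parity_minimal3 _ (h.map_mem_minimal3 hσ v hv)).2
    rwa [Multiset.card_map] at this
  have kz := sum_map_of_defect (fun v => 5 - (ι v).card) Ψ z
    (fun v hv hd => (hpar v (hz v hv)).2 (.inr (by
      have := h.card_le_five hσ v (hz v hv); omega)))
    (fun v hv hd => mt (hpar v (hz v hv)).1 (by omega))
  have ky := sum_map_of_defect (fun v => (ι v).card - 2) Ψ y
    (fun v hv hd => (hpar v (hy v hv)).2 (.inl (by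
      have := h.two_le_card (hy v hv); omega)))
    (fun v hv hd => mt (hpar v (hy v hv)).1 (by omega))
  rw [← hΨ] at kz ky
  rw [← e] at ky h2 key2
  -- The bound can fail only for odd `k`, with 5k - 2l = 1. The defects from 5 in `z` and from 2 in
  -- `y` then add up to 1, so `Ψ` vanishes on exactly one side.
  rcases (by omega : (z.map fun v => 5 - (ι v).card).sum = 0 ∧
      (y.map fun v => (ι v).card - 2).sum = 1 ∨ (z.map fun v => 5 - (ι v).card).sum = 1 ∧
      (y.map fun v => (ι v).card - 2).sum = 0) with ⟨ez, ey⟩ | ⟨ez, ey⟩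
  · exact ky.2 ey (kz.1 ez)
  · exact kz.2 ez (ky.1 ey)

theorem rank_three {s : ℤ × ℤ × ℤ → P} (hs : ∀ x ∈ cubeVecs3, σ (s x) = x) :
    catenaryDegree H = 5 ∧
      (∀ k : ℕ, 2 ≤ k → IsInterval (unionLengths H k)) ∧
      ∀ k : ℕ, 2 ≤ k → ∀ j : ℕ, j ≤ 1 → rho H (2 * k + j) = ((5 * k + j : ℕ) : ℕ∞) := by
  have h1 : ∀ u : Multiset (ℤ × ℤ × ℤ), (∀ x ∈ u, x ∈ cubeVecs3) → ∀ x ∈ u, σ (s x) = x :=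
    fun u hu x hx => hs x (hu x hx)
  have h2 : ∀ u : Multiset (ℤ × ℤ × ℤ), (∀ x ∈ u, -x ∈ cubeVecs3) → ∀ x ∈ u, σ (s (-x)) = -x :=
    fun u hu x hx => hs _ (hu x hx)
  obtain ⟨u, -, hu, -⟩ := h.exists_symmetric minZeroSum_quintuple3 (h1 _ (by decide))
    (h2 _ (by decide))
  refine ⟨le_antisymm (h.catenaryDegree_le (h.card_le_five hσ)) ?_,
    isInterval_unionLengths_and_rho hu (by norm_num) (fun n hn hn' => ?_)
      (h.le_of_mem_unionLengths_three hσ hu)⟩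
  · exact h.le_catenaryDegree (h.map_mem_minimal3 hσ) minZeroSum_quintuple3 (h1 _ (by decide))
      (h2 _ (by decide)) (by decide) minimal3_le_quintuple3
  · rcases (by omega : n = 2 ∨ n = 3 ∨ n = 4 ∨ n = 5) with rfl | rfl | rfl | rfl
    · exact self_mem_unionLengths hu 2
    · exact h.card_mem_unionLengths minZeroSum_triple3 (h1 _ (by decide)) (h2 _ (by decide))
    · exact h.card_mem_unionLengths minZeroSum_quadruple3 (h1 _ (by decide)) (h2 _ (by decide))
    · exact h.card_mem_unionLengths minZeroSum_quintuple3 (h1 _ (by decide)) (h2 _ (by decide))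

end RankThree

end IsZeroSumModel

/-! ### The Davenport constant -/

section Davenport

variable {G A : Type*} [AddCommGroup G] [AddCommGroup A]

theorem addIrreducible_iff {G₀ : Set G} (U : zeroSumMonoid G₀) :
    AddIrreducible U ↔ MinZeroSum (fun x => x) U.1 := by
  have hunit : ∀ V : zeroSumMonoid G₀, IsAddUnit V ↔ V.1 = 0 := by
    intro V
    refine ⟨fun hV => ?_, fun e => ?_⟩
    · obtain ⟨W, hW⟩ := hV.exists_neg
      exact (add_eq_zero.1 (congrArg Subtype.val hW)).1
    · rw [show V = 0 from Subtype.ext e]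
      exact isAddUnit_zero
  rw [_root_.addIrreducible_iff, MinZeroSum, hunit]
  refine and_congr_right fun _ => ⟨fun hU => ⟨by simpa using U.2.2, fun T hT h0 => ?_⟩,
    fun hU V W e => ?_⟩
  · obtain ⟨W, hW⟩ := Multiset.le_iff_exists_add.1 hT
    rw [Multiset.map_id'] at h0
    have hW0 : W.sum = 0 := by
      have := U.2.2
      rwa [hW, Multiset.sum_add, h0, zero_add] at this
    have hT' : T ∈ zeroSumMonoid G₀ := ⟨fun g hg => U.2.1 g (by simp [hW, hg]), h0⟩
    have hW' : W ∈ zeroSumMonoid G₀ := ⟨fun g hg => U.2.1 g (by simp [hW, hg]), hW0⟩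
    rcases hU (a := ⟨T, hT'⟩) (b := ⟨W, hW'⟩) (Subtype.ext hW) with hu | hu
    · exact .inl ((hunit _).1 hu)
    · have : W = 0 := (hunit _).1 hu
      exact .inr (by simpa [this] using hW.symm)
  · have e : U.1 = V.1 + W.1 := congrArg Subtype.val e
    rcases hU.2 V.1 (by rw [e]; exact Multiset.le_add_right _ _) (by simpa using V.2.2) with hV | hV
    · exact .inl ((hunit _).2 hV)
    · exact .inr ((hunit _).2 (by simpa [hV] using e))

theorem davenport_eq {G₀ : Set G} (f : G →+ A) (hf : Function.Injective f) {D : ℕ}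
    {L : List (Multiset A)} (hL : ∀ w ∈ L, w.card ≤ D)
    (hG₀ : ∀ S : Multiset G, (∀ g ∈ S, g ∈ G₀) → MinZeroSum f S → S.map f ∈ L)
    {u : Multiset A} (hu : MinZeroSum (fun x => x) u) (hc : u.card = D) (g : A → G)
    (hg : ∀ x ∈ u, g x ∈ G₀ ∧ f (g x) = x) : davenport G₀ = D := by
  refine le_antisymm (iSup_le fun ⟨U, hU⟩ => ?_) ?_
  · have h1 := (addIrreducible_iff U).1 hU
    have := hL _ (hG₀ U.1 U.2.1 ((minZeroSum_comp_iff (fun x => x) f hf U.1).2 h1))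
    rw [Multiset.card_map] at this
    exact_mod_cast this
  · have h1 : MinZeroSum (fun x => x) (u.map g) := by
      rw [← minZeroSum_comp_iff (fun x => x) f hf, minZeroSum_map (fun x => f x) g]
      exact minZeroSum_congr (fun x hx => (hg x hx).2.symm) hu
    let U : zeroSumMonoid G₀ := ⟨u.map g, fun y hy => by
      obtain ⟨x, hx, rfl⟩ := Multiset.mem_map.1 hy
      exact (hg x hx).1, by simpa using h1.2.1⟩
    refine le_trans ?_ (le_iSup (fun U : {U : zeroSumMonoid G₀ // AddIrreducible U} =>
      ((Multiset.card U.1.1 : ℕ) : ℕ∞)) ⟨U, (addIrreducible_iff U).2 h1⟩)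
    simp [U, hc]

end Davenport

/-! ### Divisor homomorphisms -/

section DivisorHom

variable {H P : Type*} [CancelCommMonoid H] {φ : H →* FreeMon P}

theorem grothendieckGroup_of_injective :
    Function.Injective (Algebra.GrothendieckGroup.of : FreeMon P → _) := by
  intro a b hab
  obtain ⟨c, hc⟩ := (Submonoid.LocalizationMap.eq_iff_exists _).1 hab
  exact Multiset.add_right_inj.1 hc

theorem divClass_eq_sum (S : Multiset P) : divClass φ (Multiplicative.ofAdd S) =
    (S.map fun p => divClass φ (Multiplicative.ofAdd {p})).sum := by
  have hmul : ∀ a b : FreeMon P, divClass φ (a * b) = divClass φ a + divClass φ b := by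
    intro a b
    simp [divClass]
  induction S using Multiset.induction_on with
  | empty => simp [divClass]
  | cons p S ih =>
    rw [Multiset.map_cons, Multiset.sum_cons, ← ih, ← hmul]
    rfl

/-- Principal divisors are quotients of elements of the image. If `a * φ x = φ y`, then `x ∣ y` by
the divisor property, and the cofactor maps to `a` by cancellation. -/
theorem divClass_eq_zero_iff (hφ : IsDivisorHom φ) (a : FreeMon P) :
    divClass φ a = 0 ↔ ∃ x, φ x = a := by
  have h1 : divClass φ a = 0 ↔ Algebra.GrothendieckGroup.of a ∈ principalDivisors φ :=
    QuotientGroup.eq_one_iff _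
  rw [h1]
  refine ⟨fun ha => ?_, ?_⟩
  · have key : ∀ g ∈ principalDivisors φ, ∃ x y, g * Algebra.GrothendieckGroup.of (φ x) =
        Algebra.GrothendieckGroup.of (φ y) := by
      intro g hg
      induction hg using Subgroup.closure_induction with
      | mem g hg =>
        obtain ⟨x, rfl⟩ := hg
        exact ⟨1, x, by simp⟩
      | one => exact ⟨1, 1, by simp⟩
      | mul g g' _ _ ih ih' =>
        obtain ⟨x, y, e⟩ := ih
        obtain ⟨x', y', e'⟩ := ih'
        exact ⟨x * x', y * y', by simp only [map_mul]; rw [mul_mul_mul_comm, e, e']⟩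
      | inv g _ ih =>
        obtain ⟨x, y, e⟩ := ih
        exact ⟨y, x, by rw [← e, inv_mul_cancel_left]⟩
    obtain ⟨x, y, e⟩ := key _ ha
    rw [← map_mul] at e
    have e := grothendieckGroup_of_injective e
    obtain ⟨t, rfl⟩ := hφ x y ⟨a, by rw [← e, mul_comm]⟩
    refine ⟨t, ?_⟩
    rw [map_mul, mul_comm] at e
    exact (Multiset.add_right_inj.1 e).symm
  · rintro ⟨x, rfl⟩
    exact Subgroup.subset_closure ⟨x, rfl⟩

theorem associated_iff_of_isDivisorHom (hφ : IsDivisorHom φ) (a b : H) :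
    Associated a b ↔ φ a = φ b := by
  refine ⟨fun ⟨u, hu⟩ => ?_, fun e => ?_⟩
  · have h1 : φ u * φ ↑u⁻¹ = 1 := by rw [← map_mul]; simp
    have h2 : Multiplicative.toAdd (φ u) = 0 :=
      (add_eq_zero.1 (h1 : Multiplicative.toAdd (φ u) + Multiplicative.toAdd (φ ↑u⁻¹) = 0)).1
    have h2 : φ u = 1 := h2
    rw [← hu, map_mul, h2, mul_one]
  · obtain ⟨t, rfl⟩ := hφ a b (e ▸ dvd_rfl)
    obtain ⟨t', e'⟩ := hφ (a * t) a (e ▸ dvd_rfl)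
    rw [mul_assoc, left_eq_mul] at e'
    exact ⟨⟨t, t', e', by rw [mul_comm, e']⟩, rfl⟩

theorem exists_isZeroSumModel (hφ : IsDivisorHom φ) {A : Type*} [AddCommGroup A]
    (f : DivClassGroup φ →+ A) (hf : Function.Injective f)
    (h0 : ∀ p, f (divClass φ (Multiplicative.ofAdd {p})) ≠ 0) :
    ∃ ι : Associates H → Multiset P,
      IsZeroSumModel (fun p => f (divClass φ (Multiplicative.ofAdd {p}))) ι := by
  let ι : Associates H → Multiset P :=
    Quotient.lift (fun a => Multiplicative.toAdd (φ a)) fun a b hab =>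
      congrArg _ ((associated_iff_of_isDivisorHom hφ a b).1 hab)
  have hι : ∀ a, ι (Associates.mk a) = Multiplicative.toAdd (φ a) := fun _ => rfl
  refine ⟨ι, ?_, ?_, ?_, ?_, h0⟩
  · rw [← Associates.mk_one, hι, map_one, toAdd_one]
  · intro x y
    obtain ⟨a, rfl⟩ := Associates.mk_surjective x
    obtain ⟨b, rfl⟩ := Associates.mk_surjective y
    rw [Associates.mk_mul_mk, hι, hι, hι, map_mul, toAdd_mul]
  · intro x y e
    obtain ⟨a, rfl⟩ := Associates.mk_surjective x
    obtain ⟨b, rfl⟩ := Associates.mk_surjective y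
    exact Associates.mk_eq_mk_iff_associated.2 ((associated_iff_of_isDivisorHom hφ a b).2 e)
  · intro S
    have e : (S.map fun p => f (divClass φ (Multiplicative.ofAdd {p}))).sum =
        f (divClass φ (Multiplicative.ofAdd S)) := by
      rw [divClass_eq_sum, map_multiset_sum, Multiset.map_map]
      rfl
    rw [e, map_eq_zero_iff f hf, divClass_eq_zero_iff hφ, Associates.mk_surjective.exists]
    rfl

end DivisorHom

/-! ### Coordinates of the class group and choice of primes -/

section Transport

variable {H P : Type*} [CancelCommMonoid H] {φ : H →* FreeMon P}

theorem exists_model_of_image {A : Type*} [AddCommGroup A] (hφ : IsDivisorHom φ)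
    (f : DivClassGroup φ →+ A) (hf : Function.Injective f) {C : List A}
    (hC : f '' primeClasses φ = {x | x ∈ C}) (h0 : 0 ∉ C) (hne : ∃ x, x ∈ C) :
    ∃ (σ : P → A) (ι : Associates H → Multiset P) (s : A → P) (g : A → DivClassGroup φ),
      IsZeroSumModel σ ι ∧ (∀ p, σ p ∈ C) ∧ (∀ x ∈ C, σ (s x) = x) ∧
        ∀ x ∈ C, g x ∈ primeClasses φ ∧ f (g x) = x := by
  have h1 : ∀ p, f (divClass φ (Multiplicative.ofAdd {p})) ∈ C := fun p =>
    (Set.ext_iff.1 hC _).1 ⟨_, ⟨p, rfl⟩, rfl⟩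
  have h2 : ∀ x ∈ C, ∃ p, f (divClass φ (Multiplicative.ofAdd {p})) = x := by
    intro x hx
    obtain ⟨_, ⟨p, rfl⟩, e⟩ := (Set.ext_iff.1 hC x).2 hx
    exact ⟨p, e⟩
  obtain ⟨x₀, hx₀⟩ := hne
  obtain ⟨p₀, -⟩ := h2 x₀ hx₀
  -- Needed to choose `s` as a total function on `A`.
  have : Nonempty P := ⟨p₀⟩
  choose! s hs using h2
  obtain ⟨ι, hι⟩ := exists_isZeroSumModel hφ f hf fun p e => h0 (e ▸ h1 p)
  exact ⟨_, ι, s, fun x => divClass φ (Multiplicative.ofAdd {s x}), hι, h1, hs,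
    fun x hx => ⟨⟨s x, rfl⟩, hs x hx⟩⟩

variable {G A : Type*} [AddCommGroup G] [AddCommGroup A]

/-- Writing coordinates through `v` removes the abstract group: for `Fin 2` and `Fin 3`, `h1` and
`h2` are finite decidable checks. -/
theorem image_hypercube {ι : Type*} (e : ι → G) (f : G →+ A) {C : List A} (v : Finset ι → A)
    (hv : ∀ I, f (∑ i ∈ I, e i) = v I) (h1 : ∀ I : Finset ι, I.Nonempty → v I ∈ C ∧ -v I ∈ C)
    (h2 : ∀ x ∈ C, ∃ I : Finset ι, I.Nonempty ∧ (v I = x ∨ -v I = x)) :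
    f '' (hypercube e ∪ -hypercube e) = {x | x ∈ C} := by
  ext x
  constructor
  · rintro ⟨g, ⟨I, hI, rfl⟩ | ⟨I, hI, hg⟩, rfl⟩
    · exact hv I ▸ (h1 I hI).1
    · rw [neg_eq_iff_eq_neg] at hg
      rw [hg, map_neg, hv]
      exact (h1 I hI).2
  · intro hx
    obtain ⟨I, hI, rfl | rfl⟩ := h2 x hx
    · exact ⟨_, .inl ⟨I, hI, rfl⟩, hv I⟩
    · exact ⟨_, .inr ⟨I, hI, neg_neg _⟩, by rw [map_neg, hv]⟩

/-- The coordinates with respect to a basis with two members. -/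
def coords2 (e : Module.Basis (Fin 2) ℤ G) : G →+ ℤ × ℤ :=
  ((e.coord 0).prod (e.coord 1)).toAddMonoidHom

/-- The coordinates with respect to a basis with three members. -/
def coords3 (e : Module.Basis (Fin 3) ℤ G) : G →+ ℤ × ℤ × ℤ :=
  ((e.coord 0).prod ((e.coord 1).prod (e.coord 2))).toAddMonoidHom

theorem coords2_injective (e : Module.Basis (Fin 2) ℤ G) : Function.Injective (coords2 e) := by
  intro a b hab
  refine e.repr.injective (Finsupp.ext fun i => ?_)
  fin_cases i
  exacts [congrArg Prod.fst hab, congrArg Prod.snd hab]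

theorem coords3_injective (e : Module.Basis (Fin 3) ℤ G) : Function.Injective (coords3 e) := by
  intro a b hab
  refine e.repr.injective (Finsupp.ext fun i => ?_)
  fin_cases i
  exacts [congrArg Prod.fst hab, congrArg (fun x => x.2.1) hab, congrArg (fun x => x.2.2) hab]

theorem coord_sum {n : ℕ} (e : Module.Basis (Fin n) ℤ G) (i : Fin n) (I : Finset (Fin n)) :
    e.coord i (∑ j ∈ I, e j) = if i ∈ I then 1 else 0 := by
  simp [map_sum, Module.Basis.coord_apply, Finsupp.single_apply]

theorem image_coords2 (e : Module.Basis (Fin 2) ℤ G) :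
    coords2 e '' (hypercube e ∪ -hypercube e) = {x | x ∈ cubeVecs2} :=
  image_hypercube e (coords2 e)
    (fun I => (if 0 ∈ I then 1 else 0, if 1 ∈ I then 1 else 0))
    (fun I => Prod.ext (coord_sum e 0 I) (coord_sum e 1 I)) (by decide) (by decide)

theorem image_coords3 (e : Module.Basis (Fin 3) ℤ G) :
    coords3 e '' (hypercube e ∪ -hypercube e) = {x | x ∈ cubeVecs3} :=
  image_hypercube e (coords3 e)
    (fun I => (if 0 ∈ I then 1 else 0, if 1 ∈ I then 1 else 0, if 2 ∈ I then 1 else 0))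
    (fun I => Prod.ext (coord_sum e 0 I) (Prod.ext (coord_sum e 1 I) (coord_sum e 2 I)))
    (by decide) (by decide)

end Transport

end KrullFact

end

open KrullFact in
theorem corollary5p5 {H : Type*} [CancelCommMonoid H] (hH : IsKrull H)
    {P : Type*} (φ : H →* FreeMon P) (hφ : IsDivisorTheory φ)
    {r : ℕ} (e : Module.Basis (Fin r) ℤ (DivClassGroup φ))
    (hGP : primeClasses φ = hypercube e ∪ -hypercube e) :
    (r = 2 →
      catenaryDegree H = 3 ∧ tameDegree H = 3 ∧ davenport (primeClasses φ) = 3 ∧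
      (∀ k : ℕ, 2 ≤ k → IsInterval (unionLengths H k)) ∧
      (∀ k : ℕ, 2 ≤ k → ∀ j : ℕ, j ≤ 1 → rho H (2 * k + j) = ((3 * k + j : ℕ) : ℕ∞))) ∧
    (r = 3 →
      catenaryDegree H = 5 ∧ davenport (primeClasses φ) = 5 ∧
      (∀ k : ℕ, 2 ≤ k → IsInterval (unionLengths H k)) ∧
      (∀ k : ℕ, 2 ≤ k → ∀ j : ℕ, j ≤ 1 → rho H (2 * k + j) = ((5 * k + j : ℕ) : ℕ∞))) := by
  constructor
  · rintro rfl
    have hC := hGP ▸ image_coords2 e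
    obtain ⟨σ, ι, s, g, hm, hσ, hs, hg⟩ := exists_model_of_image hφ.isDivisorHom (coords2 e)
      (coords2_injective e) hC (by decide) ⟨_, List.mem_cons_self⟩
    obtain ⟨h1, h2, h3, h4⟩ := hm.rank_two hσ hs
    refine ⟨h1, h2, ?_, h3, h4⟩
    exact davenport_eq (coords2 e) (coords2_injective e) (by decide)
      (fun S hS => MinZeroSum.map_mem minimal2_ne_zero exists_minimal2_le fun p hp =>
        (Set.ext_iff.1 hC _).1 ⟨p, hS p hp, rfl⟩)
      minZeroSum_triple2 rfl g
      fun x hx => hg x ((by decide : ∀ x ∈ triple2, x ∈ cubeVecs2) x hx)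
  · rintro rfl
    have hC := hGP ▸ image_coords3 e
    obtain ⟨σ, ι, s, g, hm, hσ, hs, hg⟩ := exists_model_of_image hφ.isDivisorHom (coords3 e)
      (coords3_injective e) hC (by decide) ⟨_, List.mem_cons_self⟩
    obtain ⟨h1, h2, h3⟩ := hm.rank_three hσ hs
    refine ⟨h1, ?_, h2, h3⟩
    exact davenport_eq (coords3 e) (coords3_injective e) (fun w hw => (parity_minimal3 w hw).1)
      (fun S hS => MinZeroSum.map_mem minimal3_ne_zero exists_minimal3_le fun p hp =>
        (Set.ext_iff.1 hC _).1 ⟨p, hS p hp, rfl⟩)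
      minZeroSum_quintuple3 rfl g
      fun x hx => hg x ((by decide : ∀ x ∈ quintuple3, x ∈ cubeVecs3) x hx)
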